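/- Let $\Omega\subset\mathbb R^3$ be a non-empty open set (for example a bounded or unbounded Lipschitz domain), and let $\varepsilon,\mu,\sigma\in L^\infty(\Omega,\mathbb R^{3\times3})$ be symmetric matrix valued and such that, for some constants, $0<\varepsilon_{\min}\le\eta\cdot\varepsilon\eta\le\varepsilon_{\max}$, $0<\mu_{\min}\le\eta\cdot\mu\eta\le\mu_{\max}$ and $0\le\eta\cdot\sigma\eta\le\sigma_{\max}$ a.e. in $\Omega$ for all $\eta\in\mathbb R^3$ with $|\eta|=1$. In the complex Hilbert space $L^2(\Omega)^3$ let $\operatorname{curl}$ be the distributional curl on its maximal domain $H(\operatorname{curl},\Omega)=\{u\in L^2(\Omega)^3:\operatorname{curl}u\in L^2(\Omega)^3\}$ and let $\operatorname{curl}_0:=\operatorname{curl}^*$, with domain $H_0(\operatorname{curl},\Omega)$ (i.e. $\operatorname{curl}$ with boundary condition $\nu\times u=0$ on $\partial\Omega$). For $\omega\in\mathbb C$ let $$V(\omega)=\begin{pmatrix}-i\sigma& i\operatorname{curl}\\-i\operatorname{curl}_0&0\end{pmatrix}-\omega\begin{pmatrix}\varepsilon&0\\0&\mu\end{pmatrix},\qquad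 \operatorname{dom}V(\omega)=H_0(\operatorname{curl},\Omega)\oplus H(\operatorname{curl},\Omega),$$ in $L^2(\Omega)^3\oplus L^2(\Omega)^3$, and $$\mathcal L(\omega)=\operatorname{curl}\mu^{-1}\operatorname{curl}_0-\omega(\omega\varepsilon+i\sigma),\qquad \operatorname{dom}\mathcal L(\omega)=\{E\in H_0(\operatorname{curl},\Omega):\mu^{-1}\operatorname{curl}E\in H(\operatorname{curl},\Omega)\},$$ in $L^2(\Omega)^3$. For an operator pencil $P$ in a Hilbert space $X$ let $\rho(P)$ be the set of $\omega$ such that $P(\omega)$ is bijective from its domain onto $X$ with bounded inverse, and $\sigma(P)=\mathbb C\setminus\rho(P)$; let $\sigma_p(P)$, $\sigma_c(P)$, $\sigma_r(P)$ be the sets of $\omega\in\sigma(P)$ such that $P(\omega)$ is not injective, is injective with dense range, and is injective with non-dense range, respectively; let $\sigma_{e1}(P)$, $\sigma_{e2}(P)$, $\sigma_{e3}(P)$, $\sigma_{e4}(P)$ be the sets of $\omega$ such that $P(\omega)$ is, respectively, not semi-Fredholm, not semi-Fredholm with finite nullity, not Fredholm, and not Fredholm of index $0$. Here semi-Fredholm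 means that the range is closed and that the nullity or the codimension of the range is finite, and Fredholm that the range is closed and both are finite. Then $\rho(V)\setminus\{0\}=\rho(\mathcal L)\setminus\{0\}$ and $\sigma(V)\setminus\{0\}=\sigma(\mathcal L)\setminus\{0\}$. For every $\omega\in\rho(V)$ one has $\omega\neq0$ and $\omega\in\rho(\mathcal L)$, the operator $\operatorname{curl}_0\mathcal L(\omega)^{-1}$ is everywhere defined and bounded, the operators $\mathcal L(\omega)^{-1}\operatorname{curl}$ and $\operatorname{curl}_0\mathcal L(\omega)^{-1}\operatorname{curl}$ are closable with everywhere defined bounded closures, and $$V(\omega)^{-1}=\begin{pmatrix}\omega\mathcal L(\omega)^{-1}& i\,\overline{\mathcal L(\omega)^{-1}\operatorname{curl}}\,\mu^{-1}\\-i\mu^{-1}\operatorname{curl}_0\mathcal L(\omega)^{-1}&\omega^{-1}\bigl(-\mu^{-1}+\mu^{-1}\,\overline{\operatorname{curl}_0\mathcal L(\omega)^{-1}\operatorname{curl}}\,\mu^{-1}\bigr)\end{pmatrix}.$$ Moreover $\sigma_p(V)\setminus\{0\}=\sigma_p(\mathcal L)\setminus\{0\}$, $\sigma_c(V)\setminus\{0\}=\sigma_c(\mathcal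 L)\setminus\{0\}$ and $\sigma_r(V)=\sigma_r(\mathcal L)=\emptyset$. Finally $\sigma_{ek}(V)=\sigma_{ek}(\mathcal L)$ and $0\in\sigma_{ek}(V)$ for $k=1,2,3,4$. -/

import Mathlib

open MeasureTheory


noncomputable section

namespace Maxwell

/-! ### Unbounded operators and operator pencils in a Hilbert space -/

section Abstract

variable {X : Type*} [NormedAddCommGroup X] [InnerProductSpace ℂ X]

/-- The composition `g ∘ f` of unbounded operators on its natural (maximal) domain
`{x ∈ dom f | f x ∈ dom g}`. -/
def comp (g f : X →ₗ.[ℂ] X) : X →ₗ.[ℂ] X where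
  domain :=
    { carrier := {x | ∃ h : x ∈ f.domain, f ⟨x, h⟩ ∈ g.domain}
      zero_mem' := ⟨f.domain.zero_mem, by
        have h0 : f ⟨0, f.domain.zero_mem⟩ = 0 := f.map_zero
        rw [h0]; exact g.domain.zero_mem⟩
      add_mem' := by
        rintro x y ⟨hx, hx'⟩ ⟨hy, hy'⟩
        refine ⟨f.domain.add_mem hx hy, ?_⟩
        have h := f.map_add ⟨x, hx⟩ ⟨y, hy⟩
        change f ⟨x + y, _⟩ = _ at h
        rw [h]; exact g.domain.add_mem hx' hy'
      smul_mem' := by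
        rintro c x ⟨hx, hx'⟩
        refine ⟨f.domain.smul_mem c hx, ?_⟩
        have h := f.map_smul c ⟨x, hx⟩
        change f ⟨c • x, _⟩ = _ at h
        rw [h]; exact g.domain.smul_mem c hx' }
  toFun :=
    { toFun := fun x => g ⟨f ⟨x, x.2.1⟩, x.2.2⟩
      map_add' := by
        intro x y
        rw [← g.map_add]
        congr 1
        exact Subtype.ext (f.map_add ⟨x, x.2.1⟩ ⟨y, y.2.1⟩)
      map_smul' := by
        intro c x
        rw [RingHom.id_apply, ← g.map_smul]
        congr 1
        exact Subtype.ext (f.map_smul c ⟨x, x.2.1⟩) }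

/-- A bounded everywhere defined operator, seen as an unbounded operator. -/
def ofBounded (B : X →L[ℂ] X) : X →ₗ.[ℂ] X := B.toLinearMap.toPMap ⊤

/-- `R` is the bounded, everywhere defined two-sided inverse of `T : dom T → X`. -/
def IsBoundedInverse (T : X →ₗ.[ℂ] X) (R : X →L[ℂ] X) : Prop :=
  (∀ f : X, ∃ h : R f ∈ T.domain, T ⟨R f, h⟩ = f) ∧ ∀ u : T.domain, R (T u) = u

/-- `T` is injective on its domain. -/
def IsInjective (T : X →ₗ.[ℂ] X) : Prop := LinearMap.ker T.toFun = ⊥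

/-- `T` has dense range. -/
def HasDenseRange (T : X →ₗ.[ℂ] X) : Prop := Dense (LinearMap.range T.toFun : Set X)

/-- `T` has closed range. -/
def HasClosedRange (T : X →ₗ.[ℂ] X) : Prop := IsClosed (LinearMap.range T.toFun : Set X)

/-- Finite nullity. -/
def FiniteNullity (T : X →ₗ.[ℂ] X) : Prop := FiniteDimensional ℂ (LinearMap.ker T.toFun)

/-- Finite defect, i.e. finite codimension of the range. -/
def FiniteDefect (T : X →ₗ.[ℂ] X) : Prop :=
  FiniteDimensional ℂ (X ⧸ LinearMap.range T.toFun)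

/-- The class `Φ₊` of semi-Fredholm operators with finite nullity. -/
def IsPhiPlus (T : X →ₗ.[ℂ] X) : Prop := HasClosedRange T ∧ FiniteNullity T

/-- The class `Φ₋` of semi-Fredholm operators with finite defect. -/
def IsPhiMinus (T : X →ₗ.[ℂ] X) : Prop := HasClosedRange T ∧ FiniteDefect T

/-- Fredholm operators. -/
def IsFredholm (T : X →ₗ.[ℂ] X) : Prop := IsPhiPlus T ∧ IsPhiMinus T

/-- Fredholm operators of index zero. -/
def IsFredholmIndexZero (T : X →ₗ.[ℂ] X) : Prop :=
  IsFredholm T ∧ Module.finrank ℂ (LinearMap.ker T.toFun)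
    = Module.finrank ℂ (X ⧸ LinearMap.range T.toFun)

/-- Resolvent set of an operator pencil. -/
def resolventSet (P : ℂ → X →ₗ.[ℂ] X) : Set ℂ := {ω | ∃ R, IsBoundedInverse (P ω) R}

/-- Spectrum of an operator pencil. -/
def spectrum (P : ℂ → X →ₗ.[ℂ] X) : Set ℂ := (resolventSet P)ᶜ

/-- Point spectrum of an operator pencil. -/
def pointSpectrum (P : ℂ → X →ₗ.[ℂ] X) : Set ℂ := {ω | ¬ IsInjective (P ω)}

/-- Continuous spectrum of an operator pencil. -/
def continuousSpectrum (P : ℂ → X →ₗ.[ℂ] X) : Set ℂ :=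
  {ω | ω ∈ spectrum P ∧ IsInjective (P ω) ∧ HasDenseRange (P ω)}

/-- Residual spectrum of an operator pencil. -/
def residualSpectrum (P : ℂ → X →ₗ.[ℂ] X) : Set ℂ :=
  {ω | IsInjective (P ω) ∧ ¬ HasDenseRange (P ω)}

/-- The essential spectrum `σ_{e1}`: `P ω` is not semi-Fredholm. -/
def essSpectrum1 (P : ℂ → X →ₗ.[ℂ] X) : Set ℂ := {ω | ¬ (IsPhiPlus (P ω) ∨ IsPhiMinus (P ω))}

/-- The essential spectrum `σ_{e2}`: `P ω` is not in `Φ₊`. -/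
def essSpectrum2 (P : ℂ → X →ₗ.[ℂ] X) : Set ℂ := {ω | ¬ IsPhiPlus (P ω)}

/-- The essential spectrum `σ_{e3}`: `P ω` is not Fredholm. -/
def essSpectrum3 (P : ℂ → X →ₗ.[ℂ] X) : Set ℂ := {ω | ¬ IsFredholm (P ω)}

/-- The essential spectrum `σ_{e4}`: `P ω` is not Fredholm of index zero. -/
def essSpectrum4 (P : ℂ → X →ₗ.[ℂ] X) : Set ℂ := {ω | ¬ IsFredholmIndexZero (P ω)}

/-- The bounded operator matrix `(a b; c d)` in the Hilbert space `X ⊕ X`. -/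
def blockOp (a b c d : X →L[ℂ] X) : WithLp 2 (X × X) →L[ℂ] WithLp 2 (X × X) :=
  let e := WithLp.prodContinuousLinearEquiv 2 ℂ X X
  e.symm.toContinuousLinearMap ∘L ((a.coprod b).prod (c.coprod d)) ∘L e.toContinuousLinearMap

/-- The operator matrix
`(E, H) ↦ (-i σ E + i C H - ω ε E, -i C₀ E - ω μ H)` in `X ⊕ X` with domain
`dom C₀ ⊕ dom C`, for unbounded operators `C`, `C₀` and bounded operators `ε`, `μ`, `σ`. -/
def systemOp (C C₀ : X →ₗ.[ℂ] X) (ε μ σ : X →L[ℂ] X) (ω : ℂ) :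
    WithLp 2 (X × X) →ₗ.[ℂ] WithLp 2 (X × X) where
  domain :=
    { carrier := {z | z.fst ∈ C₀.domain ∧ z.snd ∈ C.domain}
      zero_mem' := ⟨C₀.domain.zero_mem, C.domain.zero_mem⟩
      add_mem' := fun h h' => ⟨C₀.domain.add_mem h.1 h'.1, C.domain.add_mem h.2 h'.2⟩
      smul_mem' := fun r _ h => ⟨C₀.domain.smul_mem r h.1, C.domain.smul_mem r h.2⟩ }
  toFun :=
    { toFun := fun z => WithLp.toLp 2
        (-Complex.I • σ z.1.fst + Complex.I • C ⟨z.1.snd, z.2.2⟩ - ω • ε z.1.fst,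
          -Complex.I • C₀ ⟨z.1.fst, z.2.1⟩ - ω • μ z.1.snd)
      map_add' := by
        intro z w
        have h1 : C ⟨(z + w).1.snd, (z + w).2.2⟩
            = C ⟨z.1.snd, z.2.2⟩ + C ⟨w.1.snd, w.2.2⟩ :=
          C.map_add ⟨z.1.snd, z.2.2⟩ ⟨w.1.snd, w.2.2⟩
        have h2 : C₀ ⟨(z + w).1.fst, (z + w).2.1⟩
            = C₀ ⟨z.1.fst, z.2.1⟩ + C₀ ⟨w.1.fst, w.2.1⟩ :=
          C₀.map_add ⟨z.1.fst, z.2.1⟩ ⟨w.1.fst, w.2.1⟩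
        rw [h1, h2, ← WithLp.toLp_add, Prod.mk_add_mk]
        simp only [Submodule.coe_add, WithLp.add_fst, WithLp.add_snd, map_add, smul_add]
        congr 2 <;> abel
      map_smul' := by
        intro r z
        have h1 : C ⟨(r • z).1.snd, (r • z).2.2⟩ = r • C ⟨z.1.snd, z.2.2⟩ :=
          C.map_smul r ⟨z.1.snd, z.2.2⟩
        have h2 : C₀ ⟨(r • z).1.fst, (r • z).2.1⟩ = r • C₀ ⟨z.1.fst, z.2.1⟩ :=
          C₀.map_smul r ⟨z.1.fst, z.2.1⟩
        rw [h1, h2, RingHom.id_apply, ← WithLp.toLp_smul, Prod.smul_mk]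
        simp only [Submodule.coe_smul, WithLp.smul_fst, WithLp.smul_snd, map_smul, smul_add,
          smul_sub, smul_comm r] }

end Abstract

/-! ### The operators `curl` and `curl₀` -/

/-- Real three-space. -/
abbrev R3 := EuclideanSpace ℝ (Fin 3)

/-- Complex three-space, with its Hermitian inner product. -/
abbrev C3 := EuclideanSpace ℂ (Fin 3)

/-- The Hilbert space `L²(Ω)³` of complex vector fields. -/
abbrev L2 (Ω : TopologicalSpace.Opens R3) := Lp C3 2 (volume.restrict (Ω : Set R3))

/-- Partial derivative `∂ⱼ φᵢ`. -/
def partialDeriv (φ : R3 → C3) (j i : Fin 3) (x : R3) : ℂ :=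
  fderiv ℝ φ x (EuclideanSpace.single j 1) i

/-- The classical curl of a smooth vector field. -/
def classicalCurl (φ : R3 → C3) (x : R3) : C3 :=
  !₂[partialDeriv φ 1 2 x - partialDeriv φ 2 1 x,
     partialDeriv φ 2 0 x - partialDeriv φ 0 2 x,
     partialDeriv φ 0 1 x - partialDeriv φ 1 0 x]

/-- Test fields: elements of `C_c^∞(Ω)³`. -/
structure IsTestField (Ω : TopologicalSpace.Opens R3) (φ : R3 → C3) : Prop where
  smooth : ContDiff ℝ (⊤ : ℕ∞) φ
  compact : HasCompactSupport φ
  supp : tsupport φ ⊆ Ω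

/-- `curl u = w` in the distributional sense on `Ω`. -/
def IsWeakCurl {Ω : TopologicalSpace.Opens R3} (u w : L2 Ω) : Prop :=
  ∀ φ : R3 → C3, IsTestField Ω φ →
    ∫ x in (Ω : Set R3), inner ℂ (classicalCurl φ x) (u x)
      = ∫ x in (Ω : Set R3), inner ℂ (φ x) (w x)

section CurlLemmas

variable {Ω : TopologicalSpace.Opens R3}

lemma memLp_of_continuous {g : R3 → C3} (hg : Continuous g) (hc : HasCompactSupport g) :
    MemLp g 2 (volume.restrict (Ω : Set R3)) :=
  hg.memLp_of_hasCompactSupport hc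

lemma integral_inner_eq {g : R3 → C3} (hg : MemLp g 2 (volume.restrict (Ω : Set R3)))
    (u : L2 Ω) :
    ∫ x in (Ω : Set R3), inner ℂ (g x) (u x) = inner ℂ (hg.toLp g) u := by
  rw [MeasureTheory.L2.inner_def]
  refine integral_congr_ae ?_
  filter_upwards [hg.coeFn_toLp] with x hx
  rw [hx]

lemma IsTestField.continuous_partialDeriv {φ : R3 → C3} (h : IsTestField Ω φ) (j i : Fin 3) :
    Continuous (partialDeriv φ j i) := by
  have h1 : Continuous (fderiv ℝ φ) := h.smooth.continuous_fderiv (by simp)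
  unfold partialDeriv
  fun_prop

lemma IsTestField.partialDeriv_eq_zero {φ : R3 → C3} (j i : Fin 3) {x : R3}
    (hx : x ∉ tsupport φ) : partialDeriv φ j i x = 0 := by
  have : fderiv ℝ φ x = 0 := by
    by_contra hne
    exact hx (support_fderiv_subset ℝ (by simpa [Function.mem_support] using hne))
  simp [partialDeriv, this]

lemma IsTestField.memLp {φ : R3 → C3} (h : IsTestField Ω φ) :
    MemLp φ 2 (volume.restrict (Ω : Set R3)) :=
  memLp_of_continuous h.smooth.continuous h.compact

lemma IsTestField.memLp_curl {φ : R3 → C3} (h : IsTestField Ω φ) :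
    MemLp (classicalCurl φ) 2 (volume.restrict (Ω : Set R3)) := by
  refine memLp_of_continuous ?_ ?_
  · have := h.continuous_partialDeriv
    refine (PiLp.continuous_toLp 2 _).comp (continuous_pi fun i => ?_)
    fin_cases i <;> simp <;> fun_prop
  · refine HasCompactSupport.intro' h.compact (isClosed_tsupport φ) fun x hx => ?_
    have := fun j i => IsTestField.partialDeriv_eq_zero (φ := φ) j i hx
    ext i
    fin_cases i <;> simp [classicalCurl, this]

lemma isWeakCurl_iff {u w : L2 Ω} : IsWeakCurl u w ↔ ∀ φ (h : IsTestField Ω φ),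
    inner ℂ (h.memLp_curl.toLp _) u = inner ℂ (h.memLp.toLp _) w := by
  refine forall₂_congr fun φ h => ?_
  rw [integral_inner_eq h.memLp_curl, integral_inner_eq h.memLp]

/-- An `L²` field orthogonal to all test fields vanishes. -/
lemma eq_zero_of_testField {w : L2 Ω}
    (hw : ∀ φ (h : IsTestField Ω φ), inner ℂ (h.memLp.toLp φ) w = 0) : w = 0 := by
  have key : ∀ i : Fin 3, ∀ᵐ x ∂(volume : Measure R3), x ∈ (Ω : Set R3) → w x i = 0 := by
    intro i
    refine Ω.isOpen.ae_eq_zero_of_integral_contDiff_smul_eq_zero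
      (f := fun x => w x i) ?_ fun g hg hc hs => ?_
    · have h1 : LocallyIntegrableOn (fun x => w x) (Ω : Set R3) volume := by
        have h2 : LocallyIntegrable (fun x => w x) (volume.restrict (Ω : Set R3)) :=
          (Lp.memLp w).locallyIntegrable (by norm_num)
        exact locallyIntegrableOn_of_locallyIntegrable_restrict h2
      intro x hx
      obtain ⟨s, hs, hi⟩ := h1 x hx
      refine ⟨s, hs, ?_⟩
      exact (EuclideanSpace.proj (𝕜 := ℂ) i).integrable_comp hi
    · set φ : R3 → C3 := fun x => (g x : ℂ) • EuclideanSpace.single i (1 : ℂ) with hφ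
      have ht : tsupport φ ⊆ tsupport g := closure_mono fun x hx hgx => hx (by simp [hφ, hgx])
      have hT : IsTestField Ω φ := by
        refine ⟨?_, ?_, ht.trans hs⟩
        · have : ContDiff ℝ (⊤ : ℕ∞) fun x => (g x : ℂ) := Complex.ofRealCLM.contDiff.comp hg
          exact this.smul contDiff_const
        · exact hc.of_isClosed_subset (isClosed_tsupport φ) ht
      have h3 := hw φ hT
      rw [← integral_inner_eq hT.memLp] at h3
      have h4 : ∀ x, inner ℂ (φ x) (w x) = g x • w x i := by
        intro x
        simp [hφ, EuclideanSpace.inner_single_left]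
      simp_rw [h4] at h3
      rw [← h3]
      refine (setIntegral_eq_integral_of_forall_compl_eq_zero fun x hx => ?_).symm
      have : g x = 0 := by
        by_contra hne
        exact hx (hs (subset_tsupport g hne))
      simp [this]
  refine Lp.eq_zero_iff_ae_eq_zero.2 ?_
  rw [Filter.EventuallyEq, ae_restrict_iff' Ω.isOpen.measurableSet]
  filter_upwards [key 0, key 1, key 2] with x h0 h1 h2 hx
  ext i
  fin_cases i
  · exact h0 hx
  · exact h1 hx
  · exact h2 hx

lemma IsWeakCurl.unique {u w w' : L2 Ω} (h : IsWeakCurl u w) (h' : IsWeakCurl u w') : w = w' := by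
  rw [isWeakCurl_iff] at h h'
  refine sub_eq_zero.1 (eq_zero_of_testField fun φ hφ => ?_)
  rw [inner_sub_right, ← h φ hφ, ← h' φ hφ, sub_self]

end CurlLemmas

/-- The graph `{(u, curl u)}` of the maximal operator `curl` in `L²(Ω)³`. -/
def curlGraph (Ω : TopologicalSpace.Opens R3) : Submodule ℂ (L2 Ω × L2 Ω) where
  carrier := {p | IsWeakCurl p.1 p.2}
  zero_mem' := by
    rw [Set.mem_ofPred_eq, isWeakCurl_iff]
    intro φ h
    simp
  add_mem' := by
    intro p q hp hq
    rw [Set.mem_ofPred_eq, isWeakCurl_iff] at *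
    intro φ h
    simp only [Prod.fst_add, Prod.snd_add, inner_add_right, hp φ h, hq φ h]
  smul_mem' := by
    intro c p hp
    rw [Set.mem_ofPred_eq, isWeakCurl_iff] at *
    intro φ h
    simp only [Prod.smul_fst, Prod.smul_snd, inner_smul_right, hp φ h]

/-- The operator `curl` in `L²(Ω)³` on its maximal domain
`H(curl, Ω) = {u ∈ L²(Ω)³ | curl u ∈ L²(Ω)³}`. -/
def curl (Ω : TopologicalSpace.Opens R3) : L2 Ω →ₗ.[ℂ] L2 Ω := (curlGraph Ω).toLinearPMap

lemma curl_graph (Ω : TopologicalSpace.Opens R3) : (curl Ω).graph = curlGraph Ω := by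
  refine Submodule.toLinearPMap_graph_eq _ fun p hp h0 => ?_
  have h1 : IsWeakCurl p.1 p.2 := hp
  rw [h0] at h1
  exact h1.unique (curlGraph Ω).zero_mem

section Green

variable {Ω : TopologicalSpace.Opens R3} {φ ψ : R3 → C3}

lemma IsTestField.contDiff_apply (h : IsTestField Ω φ) (i : Fin 3) :
    ContDiff ℝ (⊤ : ℕ∞) fun x => φ x i :=
  (EuclideanSpace.proj (𝕜 := ℂ) i).restrictScalars ℝ |>.contDiff.comp h.smooth

lemma IsTestField.partialDeriv_eq (h : IsTestField Ω φ) (j i : Fin 3) (x : R3) :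
    partialDeriv φ j i x = fderiv ℝ (fun y => φ y i) x (EuclideanSpace.single j 1) := by
  have h1 : HasFDerivAt φ (fderiv ℝ φ x) x :=
    (h.smooth.differentiable (by simp) x).hasFDerivAt
  have h2 := (((EuclideanSpace.proj (𝕜 := ℂ) (ι := Fin 3) i).restrictScalars ℝ).hasFDerivAt
    (x := φ x)).comp x h1
  have h3 : fderiv ℝ (fun y => φ y i) x = _ := h2.fderiv
  rw [h3]
  rfl

lemma IsTestField.conj_partialDeriv_eq (h : IsTestField Ω φ) (j i : Fin 3) (x : R3) :
    starRingEnd ℂ (partialDeriv φ j i x)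
      = fderiv ℝ (fun y => starRingEnd ℂ (φ y i)) x (EuclideanSpace.single j 1) := by
  have h1 : HasFDerivAt (fun y => φ y i) (fderiv ℝ (fun y => φ y i) x) x :=
    ((h.contDiff_apply i).differentiable (by simp) x).hasFDerivAt
  have h2 := ((Complex.conjCLE.toContinuousLinearMap).hasFDerivAt (x := φ x i)).comp x h1
  have h3 : fderiv ℝ (fun y => starRingEnd ℂ (φ y i)) x = _ := h2.fderiv
  rw [h3, h.partialDeriv_eq]
  rfl

lemma integrable_partialDeriv_mul (hφ : IsTestField Ω φ) (hψ : IsTestField Ω ψ) (j i k : Fin 3) :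
    Integrable (fun x => starRingEnd ℂ (partialDeriv φ j i x) * ψ x k) := by
  refine Continuous.integrable_of_hasCompactSupport ?_ ?_
  · have h1 := hφ.continuous_partialDeriv j i
    have h2 := (hψ.contDiff_apply k).continuous
    exact (Complex.continuous_conj.comp h1).mul h2
  · refine HasCompactSupport.intro' hψ.compact (isClosed_tsupport ψ) fun x hx => ?_
    simp [image_eq_zero_of_notMem_tsupport hx]

lemma integrable_mul_partialDeriv (hφ : IsTestField Ω φ) (hψ : IsTestField Ω ψ) (j i k : Fin 3) :
    Integrable (fun x => starRingEnd ℂ (φ x i) * partialDeriv ψ j k x) := by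
  refine Continuous.integrable_of_hasCompactSupport ?_ ?_
  · have h1 := hψ.continuous_partialDeriv j k
    have h2 := (hφ.contDiff_apply i).continuous
    exact (Complex.continuous_conj.comp h2).mul h1
  · refine HasCompactSupport.intro' hφ.compact (isClosed_tsupport φ) fun x hx => ?_
    simp [image_eq_zero_of_notMem_tsupport hx]

lemma integral_partialDeriv_mul (hφ : IsTestField Ω φ) (hψ : IsTestField Ω ψ) (j i k : Fin 3) :
    ∫ x, starRingEnd ℂ (partialDeriv φ j i x) * ψ x k
      = -∫ x, starRingEnd ℂ (φ x i) * partialDeriv ψ j k x := by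
  have h1 := integrable_partialDeriv_mul hφ hψ j i k
  have h2 := integrable_mul_partialDeriv hφ hψ j i k
  simp only [hφ.conj_partialDeriv_eq, hψ.partialDeriv_eq] at h1 h2 ⊢
  rw [integral_mul_fderiv_eq_neg_fderiv_mul_of_integrable h1 h2, neg_neg]
  · refine Continuous.integrable_of_hasCompactSupport ?_ ?_
    · exact (Complex.continuous_conj.comp (hφ.contDiff_apply i).continuous).mul
        (hψ.contDiff_apply k).continuous
    · refine HasCompactSupport.intro' hφ.compact (isClosed_tsupport φ) fun x hx => ?_
      simp [image_eq_zero_of_notMem_tsupport hx]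
  · intro x _
    exact (Complex.conjCLE.toContinuousLinearMap.differentiableAt).comp x
      ((hφ.contDiff_apply i).differentiable (by simp) x)
  · intro x _
    exact (hψ.contDiff_apply k).differentiable (by simp) x

lemma integral_curl_aux {a b c d e f : R3 → ℂ} (ha : Integrable a) (hb : Integrable b)
    (hc : Integrable c) (hd : Integrable d) (he : Integrable e) (hf : Integrable f) :
    ∫ x, (a x - b x + (c x - d x) + (e x - f x))
      = (∫ x, a x) - (∫ x, b x) + ((∫ x, c x) - (∫ x, d x)) + ((∫ x, e x) - (∫ x, f x)) := by
  have h1 : Integrable fun x => a x - b x := ha.sub hb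
  have h2 : Integrable fun x => c x - d x := hc.sub hd
  have h3 : Integrable fun x => e x - f x := he.sub hf
  have h4 : Integrable fun x => a x - b x + (c x - d x) := h1.add h2
  rw [integral_add h4 h3, integral_add h1 h2, integral_sub ha hb, integral_sub hc hd,
    integral_sub he hf]

end Green

/-- Green's formula for test fields: the classical curl of a test field is its weak curl. -/
lemma IsTestField.isWeakCurl {Ω : TopologicalSpace.Opens R3} {ψ : R3 → C3}
    (h : IsTestField Ω ψ) : IsWeakCurl (h.memLp.toLp ψ) (h.memLp_curl.toLp (classicalCurl ψ)) := by
  intro φ hφ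
  have e1 : ∫ x in (Ω : Set R3), inner ℂ (classicalCurl φ x) (h.memLp.toLp ψ x)
      = ∫ x, inner ℂ (classicalCurl φ x) (ψ x) := by
    rw [← setIntegral_eq_integral_of_forall_compl_eq_zero (s := (Ω : Set R3))
      (f := fun x => inner ℂ (classicalCurl φ x) (ψ x))]
    · refine integral_congr_ae ?_
      filter_upwards [h.memLp.coeFn_toLp] with x hx
      rw [hx]
    · intro x hx
      rw [image_eq_zero_of_notMem_tsupport fun hx' => hx (h.supp hx'), inner_zero_right]
  have e2 : ∫ x in (Ω : Set R3), inner ℂ (φ x) (h.memLp_curl.toLp (classicalCurl ψ) x)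
      = ∫ x, inner ℂ (φ x) (classicalCurl ψ x) := by
    rw [← setIntegral_eq_integral_of_forall_compl_eq_zero (s := (Ω : Set R3))
      (f := fun x => inner ℂ (φ x) (classicalCurl ψ x))]
    · refine integral_congr_ae ?_
      filter_upwards [h.memLp_curl.coeFn_toLp] with x hx
      rw [hx]
    · intro x hx
      rw [image_eq_zero_of_notMem_tsupport fun hx' => hx (hφ.supp hx'), inner_zero_left]
  rw [e1, e2]
  have ip := fun j i k => integral_partialDeriv_mul hφ h j i k
  have i1 := fun j i k => (integrable_partialDeriv_mul hφ h j i k)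
  have i2 := fun j i k => (integrable_mul_partialDeriv hφ h j i k)
  have f1 : ∀ x, inner ℂ (classicalCurl φ x) (ψ x)
      = starRingEnd ℂ (partialDeriv φ 1 2 x) * ψ x 0 - starRingEnd ℂ (partialDeriv φ 2 1 x) * ψ x 0
      + (starRingEnd ℂ (partialDeriv φ 2 0 x) * ψ x 1 - starRingEnd ℂ (partialDeriv φ 0 2 x) * ψ x 1)
      + (starRingEnd ℂ (partialDeriv φ 0 1 x) * ψ x 2
        - starRingEnd ℂ (partialDeriv φ 1 0 x) * ψ x 2) := by
    intro x
    simp [classicalCurl, PiLp.inner_apply, Fin.sum_univ_three]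
    ring
  have f2 : ∀ x, inner ℂ (φ x) (classicalCurl ψ x)
      = starRingEnd ℂ (φ x 0) * partialDeriv ψ 1 2 x - starRingEnd ℂ (φ x 0) * partialDeriv ψ 2 1 x
      + (starRingEnd ℂ (φ x 1) * partialDeriv ψ 2 0 x - starRingEnd ℂ (φ x 1) * partialDeriv ψ 0 2 x)
      + (starRingEnd ℂ (φ x 2) * partialDeriv ψ 0 1 x
        - starRingEnd ℂ (φ x 2) * partialDeriv ψ 1 0 x) := by
    intro x
    simp [classicalCurl, PiLp.inner_apply, Fin.sum_univ_three]
    ring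
  simp_rw [f1, f2]
  rw [integral_curl_aux (i1 _ _ _) (i1 _ _ _) (i1 _ _ _) (i1 _ _ _) (i1 _ _ _) (i1 _ _ _),
    integral_curl_aux (i2 _ _ _) (i2 _ _ _) (i2 _ _ _) (i2 _ _ _) (i2 _ _ _) (i2 _ _ _)]
  simp only [ip]
  ring

/-- `curl` is densely defined, so that its adjoint is the genuine adjoint. -/
lemma dense_curl_domain (Ω : TopologicalSpace.Opens R3) : Dense ((curl Ω).domain : Set (L2 Ω)) := by
  rw [Submodule.dense_iff_topologicalClosure_eq_top, Submodule.topologicalClosure_eq_top_iff,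
    Submodule.eq_bot_iff]
  intro w hw
  refine eq_zero_of_testField fun φ h => (Submodule.mem_orthogonal _ _).1 hw _ ?_
  exact ⟨(_, _), h.isWeakCurl, rfl⟩

/-- The operator `curl₀ = curl*`, whose domain is `H₀(curl, Ω)`. -/
def curl₀ (Ω : TopologicalSpace.Opens R3) : L2 Ω →ₗ.[ℂ] L2 Ω := (curl Ω).adjoint


/-- `curl₀` is a restriction of `curl`; its domain consists of the `u ∈ H(curl, Ω)` with
`⟨curl u, v⟩ = ⟨u, curl v⟩` for all `v ∈ H(curl, Ω)`, the weak form of `ν × u = 0`. -/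
lemma curl₀_le_curl (Ω : TopologicalSpace.Opens R3) : curl₀ Ω ≤ curl Ω := by
  refine LinearPMap.le_of_le_graph ?_
  rw [curl_graph]
  rintro ⟨u, w⟩ hu
  obtain ⟨y, hy, hw⟩ := (LinearPMap.mem_graph_iff _).1 hu
  obtain rfl : (y : L2 Ω) = u := hy
  obtain rfl : curl₀ Ω y = w := hw
  refine isWeakCurl_iff.2 fun φ h => ?_
  have hg : (h.memLp.toLp φ, h.memLp_curl.toLp (classicalCurl φ)) ∈ (curl Ω).graph := by
    rw [curl_graph]
    exact h.isWeakCurl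
  obtain ⟨x, hx, hx'⟩ := (LinearPMap.mem_graph_iff _).1 hg
  have := LinearPMap.adjoint_isFormalAdjoint (dense_curl_domain Ω) y x
  simp only at hx hx'
  rw [hx, hx'] at this
  change inner ℂ (curl₀ Ω y) _ = _ at this
  rw [← inner_conj_symm, ← this, inner_conj_symm]

/-! ### Coefficients -/

/-- A coefficient in `L^∞(Ω, ℝ^{3×3})`. -/
structure MatrixField (Ω : TopologicalSpace.Opens R3) where
  toFun : R3 → Matrix (Fin 3) (Fin 3) ℝ
  aestronglyMeasurable : ∀ i j,
    AEStronglyMeasurable (fun x => toFun x i j) (volume.restrict (Ω : Set R3))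
  bounded : ∃ C : ℝ, ∀ᵐ x ∂(volume.restrict (Ω : Set R3)), ∀ i j, |toFun x i j| ≤ C

/-- For almost all `x ∈ Ω` the matrix `M x` is symmetric and `a ≤ η · M x η ≤ b` for all
unit vectors `η ∈ ℝ³`. -/
def MatrixField.HasBounds {Ω : TopologicalSpace.Opens R3} (M : MatrixField Ω) (a b : ℝ) : Prop :=
  ∀ᵐ x ∂(volume.restrict (Ω : Set R3)), (M.toFun x).IsSymm ∧
    ∀ η : Fin 3 → ℝ, η ⬝ᵥ η = 1 →
      a ≤ η ⬝ᵥ (M.toFun x).mulVec η ∧ η ⬝ᵥ (M.toFun x).mulVec η ≤ b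

/-- A real matrix acting on `ℂ³`. -/
def matVec (A : Matrix (Fin 3) (Fin 3) ℝ) (v : C3) : C3 :=
  WithLp.toLp 2 fun i => ∑ j, (A i j : ℂ) * v j

lemma matVec_add (A : Matrix (Fin 3) (Fin 3) ℝ) (v w : C3) :
    matVec A (v + w) = matVec A v + matVec A w := by
  ext i
  simp [matVec, mul_add, Finset.sum_add_distrib]

lemma matVec_smul (A : Matrix (Fin 3) (Fin 3) ℝ) (c : ℂ) (v : C3) :
    matVec A (c • v) = c • matVec A v := by
  ext i
  simp [matVec, Finset.mul_sum, mul_left_comm]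

lemma norm_matVec_le {A : Matrix (Fin 3) (Fin 3) ℝ} {C : ℝ} (h : ∀ i j, |A i j| ≤ C) (v : C3) :
    ‖matVec A v‖ ≤ 9 * C * ‖v‖ := by
  have hC : 0 ≤ C := (abs_nonneg _).trans (h 0 0)
  have hent : ∀ i, ‖matVec A v i‖ ≤ 3 * C * ‖v‖ := by
    intro i
    have h1 : ∀ j, ‖(A i j : ℂ) * v j‖ ≤ C * ‖v‖ := by
      intro j
      rw [norm_mul, Complex.norm_real, Real.norm_eq_abs]
      exact mul_le_mul (h i j) (PiLp.norm_apply_le v j) (norm_nonneg _) hC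
    have h0 : matVec A v i = ∑ j, (A i j : ℂ) * v j := rfl
    rw [h0]
    calc ‖∑ j, (A i j : ℂ) * v j‖ ≤ ∑ j, ‖(A i j : ℂ) * v j‖ := norm_sum_le _ _
      _ ≤ ∑ _j : Fin 3, C * ‖v‖ := Finset.sum_le_sum fun j _ => h1 j
      _ = 3 * C * ‖v‖ := by simp; ring
  have hD : 0 ≤ 3 * C * ‖v‖ := by positivity
  rw [EuclideanSpace.norm_eq]
  refine Real.sqrt_le_iff.2 ⟨by positivity, ?_⟩
  have h2 : ∀ i, ‖matVec A v i‖ ^ 2 ≤ (3 * C * ‖v‖) ^ 2 := fun i =>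
    pow_le_pow_left₀ (norm_nonneg _) (hent i) 2
  rw [Fin.sum_univ_three]
  nlinarith [h2 0, h2 1, h2 2]

section Multiplication

variable {Ω : TopologicalSpace.Opens R3}

lemma MatrixField.memLp (M : MatrixField Ω) (f : L2 Ω) :
    MemLp (fun x => matVec (M.toFun x) (f x)) 2 (volume.restrict (Ω : Set R3)) := by
  obtain ⟨C, hC⟩ := M.bounded
  refine (Lp.memLp f).of_le_mul (c := 9 * C) ?_ ?_
  · have hf : AEStronglyMeasurable f (volume.restrict (Ω : Set R3)) := Lp.aestronglyMeasurable f
    have hfj : ∀ j, AEStronglyMeasurable (fun x => f x j) (volume.restrict (Ω : Set R3)) := fun j =>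
      (EuclideanSpace.proj (𝕜 := ℂ) j).continuous.comp_aestronglyMeasurable hf
    refine (PiLp.continuous_toLp 2 (fun _ : Fin 3 => ℂ)).comp_aestronglyMeasurable ?_
    refine (aemeasurable_pi_lambda _ fun i => AEStronglyMeasurable.aemeasurable ?_
      ).aestronglyMeasurable
    refine Finset.aestronglyMeasurable_fun_sum _ fun j _ => ?_
    exact (Complex.continuous_ofReal.comp_aestronglyMeasurable
      (M.aestronglyMeasurable i j)).mul (hfj j)
  · filter_upwards [hC] with x hx
    exact norm_matVec_le hx (f x)

lemma MatrixField.exists_norm_le (M : MatrixField Ω) :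
    ∃ C : ℝ, ∀ f : L2 Ω, ‖(M.memLp f).toLp _‖ ≤ C * ‖f‖ := by
  obtain ⟨C, hC⟩ := M.bounded
  refine ⟨9 * C, fun f => ?_⟩
  refine Lp.norm_le_mul_norm_of_ae_le_mul ?_
  filter_upwards [hC, (M.memLp f).coeFn_toLp] with x hx h1
  rw [h1]
  exact norm_matVec_le hx (f x)

/-- Multiplication by the coefficient `M` in `L²(Ω)³`, as a linear map. -/
def MatrixField.linearOp (M : MatrixField Ω) : L2 Ω →ₗ[ℂ] L2 Ω where
  toFun f := (M.memLp f).toLp _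
  map_add' f g := by
    rw [← MemLp.toLp_add]
    refine MemLp.toLp_congr _ _ ?_
    filter_upwards [Lp.coeFn_add f g] with x hx
    rw [hx]
    exact matVec_add _ _ _
  map_smul' r f := by
    rw [RingHom.id_apply, ← MemLp.toLp_const_smul]
    refine MemLp.toLp_congr _ _ ?_
    filter_upwards [Lp.coeFn_smul r f] with x hx
    rw [hx]
    exact matVec_smul _ _ _

/-- The bounded operator `(M f)(x) = M(x) f(x)` of multiplication by `M` in `L²(Ω)³`. -/
def MatrixField.op (M : MatrixField Ω) : L2 Ω →L[ℂ] L2 Ω :=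
  M.linearOp.mkContinuousOfExistsBound M.exists_norm_le

end Multiplication

lemma coercive_of_unit {A : Matrix (Fin 3) (Fin 3) ℝ} {a : ℝ}
    (h : ∀ η : Fin 3 → ℝ, η ⬝ᵥ η = 1 → a ≤ η ⬝ᵥ A.mulVec η) (v : Fin 3 → ℝ) :
    a * (v ⬝ᵥ v) ≤ v ⬝ᵥ A.mulVec v := by
  by_cases hv : v = 0
  · simp [hv]
  have hs : 0 < v ⬝ᵥ v := lt_of_le_of_ne
    (Finset.sum_nonneg fun i _ => mul_self_nonneg (v i))
    (fun h0 => hv (dotProduct_self_eq_zero.1 h0.symm))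
  set r := Real.sqrt (v ⬝ᵥ v) with hr
  have hr0 : 0 < r := Real.sqrt_pos.2 hs
  have hrr : r * r = v ⬝ᵥ v := Real.mul_self_sqrt hs.le
  have h1 := h (r⁻¹ • v) (by
    rw [smul_dotProduct, dotProduct_smul, smul_eq_mul, smul_eq_mul, ← hrr]
    field_simp)
  rw [Matrix.mulVec_smul, smul_dotProduct, dotProduct_smul, smul_eq_mul, smul_eq_mul] at h1
  have h2 : a * (r * r) ≤ r⁻¹ * (r⁻¹ * (v ⬝ᵥ A.mulVec v)) * (r * r) := by
    have := mul_le_mul_of_nonneg_right h1 (mul_self_nonneg r)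
    exact this
  have h3 : r⁻¹ * (r⁻¹ * (v ⬝ᵥ A.mulVec v)) * (r * r) = v ⬝ᵥ A.mulVec v := by
    field_simp
  rw [← hrr]
  linarith

lemma abs_inv_entry_le {A : Matrix (Fin 3) (Fin 3) ℝ} {a : ℝ} (ha : 0 < a)
    (h : ∀ η : Fin 3 → ℝ, η ⬝ᵥ η = 1 → a ≤ η ⬝ᵥ A.mulVec η) (i j : Fin 3) :
    |A⁻¹ i j| ≤ a⁻¹ := by
  have hco := coercive_of_unit h
  have hdet : IsUnit A.det := by
    rw [isUnit_iff_ne_zero]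
    intro h0
    obtain ⟨v, hv, hAv⟩ := Matrix.exists_mulVec_eq_zero_iff.2 h0
    have h1 := hco v
    rw [hAv, dotProduct_zero] at h1
    have h2 : 0 ≤ v ⬝ᵥ v := Finset.sum_nonneg fun i _ => mul_self_nonneg (v i)
    have h3 : v ⬝ᵥ v = 0 := by nlinarith
    exact hv (dotProduct_self_eq_zero.1 h3)
  set v : Fin 3 → ℝ := A⁻¹.mulVec (Pi.single j 1) with hv
  have hvi : ∀ k, v k = A⁻¹ k j := fun k => by simp [hv]
  have hAv : A.mulVec v = Pi.single j 1 := by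
    rw [hv, Matrix.mulVec_mulVec, Matrix.mul_nonsing_inv A hdet, Matrix.one_mulVec]
  have h1 := hco v
  rw [hAv, dotProduct_single, mul_one] at h1
  have hle : ∀ k, v k ^ 2 ≤ v ⬝ᵥ v := fun k => by
    have := Finset.single_le_sum (f := fun k => v k * v k) (fun k _ => mul_self_nonneg (v k))
      (Finset.mem_univ k)
    rw [sq]
    exact this
  have hs : 0 ≤ v ⬝ᵥ v := (sq_nonneg _).trans (hle i)
  rw [← hvi]
  refine abs_le_of_sq_le_sq ?_ (inv_pos.2 ha).le
  have h2 : (a * (v ⬝ᵥ v)) ^ 2 ≤ v ⬝ᵥ v :=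
    (pow_le_pow_left₀ (by positivity) h1 2).trans (hle j)
  have h3 : a ^ 2 * (v ⬝ᵥ v) ≤ 1 := by
    by_contra hcon
    push Not at hcon
    have : 0 < v ⬝ᵥ v := lt_of_le_of_ne hs fun h0 => by rw [← h0] at hcon; linarith
    nlinarith
  have h4 : v ⬝ᵥ v ≤ a⁻¹ ^ 2 := by
    rw [inv_pow, ← one_div, le_div_iff₀ (by positivity)]
    linarith
  exact (hle i).trans h4

/-- The pointwise inverse `x ↦ (M x)⁻¹` of a uniformly positive coefficient. -/
def MatrixField.inv {Ω : TopologicalSpace.Opens R3} (M : MatrixField Ω) {a b : ℝ} (ha : 0 < a)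
    (h : M.HasBounds a b) : MatrixField Ω where
  toFun x := (M.toFun x)⁻¹
  aestronglyMeasurable i j := by
    have hm := fun i j => (M.aestronglyMeasurable i j).aemeasurable
    have hdet : AEMeasurable (fun x => (M.toFun x).det) (volume.restrict (Ω : Set R3)) := by
      simp only [Matrix.det_fin_three]
      fun_prop
    have hadj : AEMeasurable (fun x => (M.toFun x).adjugate i j)
        (volume.restrict (Ω : Set R3)) := by
      simp only [Matrix.adjugate_fin_three]
      fin_cases i <;> fin_cases j <;> simp <;> fun_prop
    simp only [Matrix.inv_def, Matrix.smul_apply, Ring.inverse_eq_inv, smul_eq_mul]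
    exact (hdet.inv.mul hadj).aestronglyMeasurable
  bounded := by
    refine ⟨a⁻¹, ?_⟩
    filter_upwards [h] with x hx
    exact abs_inv_entry_le ha fun η hη => (hx.2 η hη).1

/-- The data of a Maxwell system: permittivity `eps`, permeability `mu`, conductivity `sigma`. -/
structure Coefficients (Ω : TopologicalSpace.Opens R3) where
  eps : MatrixField Ω
  mu : MatrixField Ω
  sigma : MatrixField Ω
  epsMin : ℝ
  epsMax : ℝ
  muMin : ℝ
  muMax : ℝ
  sigmaMax : ℝ
  epsMin_pos : 0 < epsMin
  muMin_pos : 0 < muMin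
  eps_bounds : eps.HasBounds epsMin epsMax
  mu_bounds : mu.HasBounds muMin muMax
  sigma_bounds : sigma.HasBounds 0 sigmaMax

/-! ### The Maxwell pencil and the quadratic pencil -/

section Pencils

variable {Ω : TopologicalSpace.Opens R3} (c : Coefficients Ω)

/-- The coefficient `μ⁻¹`. -/
def Coefficients.muInv : MatrixField Ω := c.mu.inv c.muMin_pos c.mu_bounds

/-- The Maxwell pencil
`V(ω)(E, H) = (-iσE + i curl H - ωεE, -i curl₀ E - ωμH)` in `L²(Ω)³ ⊕ L²(Ω)³`
on the domain `H₀(curl, Ω) ⊕ H(curl, Ω)`. -/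
def maxwellPencil (ω : ℂ) : WithLp 2 (L2 Ω × L2 Ω) →ₗ.[ℂ] WithLp 2 (L2 Ω × L2 Ω) :=
  systemOp (curl Ω) (curl₀ Ω) c.eps.op c.mu.op c.sigma.op ω

/-- The operator `curl μ⁻¹ curl₀` on
`{E ∈ H₀(curl, Ω) | μ⁻¹ curl E ∈ H(curl, Ω)}`. -/
def curlMuInvCurl : L2 Ω →ₗ.[ℂ] L2 Ω :=
  comp (curl Ω) (c.muInv.op.toLinearMap.compPMap (curl₀ Ω))

/-- The quadratic pencil `𝓛(ω) = curl μ⁻¹ curl₀ - ω(ωε + iσ)` in `L²(Ω)³`. -/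
def quadraticPencil (ω : ℂ) : L2 Ω →ₗ.[ℂ] L2 Ω where
  domain := (curlMuInvCurl c).domain
  toFun := (curlMuInvCurl c).toFun
    - (ω • (ω • c.eps.op + Complex.I • c.sigma.op)).toLinearMap ∘ₗ
        (curlMuInvCurl c).domain.subtype

end Pencils

end Maxwell

end

noncomputable section

namespace Maxwell

/-! ### Unbounded operators through their graphs -/

section Graphs

variable {X : Type*} [NormedAddCommGroup X] [InnerProductSpace ℂ X]

/-! The quadratic pencil is, up to the factor `ω`, the Schur complement of the Maxwell system. For
`ω ≠ 0` the second equation with zero right-hand side gives `H = -i ω⁻¹ μ⁻¹ curl₀ E`, and inserting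
this in the first leaves `ω⁻¹ 𝓛(ω) E`. Hence the first component maps `ker V(ω)` isomorphically onto
`ker 𝓛(ω)` (`nonempty_nullSpace_equiv`).

Ranges are compared by solving the second equation boundedly: `exists_bounded_solution` gives for
each `g` some `z`, depending continuously on `g`, with `V(ω) z = (K g, g)` and `K` bounded.
Subtracting it shows that `(f, g)` lies in the range of `V(ω)` exactly when `f - K g` lies in the
range of `𝓛(ω)`. So one range is the preimage of the other under a bounded surjection
(`exists_range_eq_comap`), and closedness, density and codimension all transfer. The source of
boundedness is the Lax-Milgram argument of `exists_auxiliary_solution` on the graph of `curl`. It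
also yields the system inverse from `𝓛(ω)⁻¹`, while the entries of the resolvent formula are read
off the blocks of `V(ω)⁻¹` (`inverse_formula`).

The residual spectrum is empty because the coefficients are real and symmetric: complex conjugation
sends vectors orthogonal to the range of `𝓛(ω)` into its kernel (`map_mem_nullSpace`), so
injectivity forces dense range. This passes to `V(ω)` for `ω ≠ 0`.

At `ω = 0` both operators have infinite nullity and infinite defect, because `ker curl₀` contains
the gradients of test functions (`not_finiteDimensional_nullSpace_curl₀`). Thus `0` belongs to every
essential spectrum and to neither resolvent set. -/

lemma mem_graph_comp {g f : X →ₗ.[ℂ] X} {x y : X} :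
    (x, y) ∈ (comp g f).graph ↔ ∃ v, (x, v) ∈ f.graph ∧ (v, y) ∈ g.graph := by
  constructor
  · intro h
    obtain ⟨⟨a, ha, hb⟩, rfl, rfl⟩ := (LinearPMap.mem_graph_iff _).1 h
    exact ⟨f ⟨a, ha⟩, LinearPMap.mem_graph f ⟨a, ha⟩, LinearPMap.mem_graph g ⟨f ⟨a, ha⟩, hb⟩⟩
  · rintro ⟨v, h1, h2⟩
    obtain ⟨a, rfl, rfl⟩ := (LinearPMap.mem_graph_iff _).1 h1
    obtain ⟨b, hb, rfl⟩ := (LinearPMap.mem_graph_iff _).1 h2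
    have hfa : f a ∈ g.domain := by
      have h := b.2
      rwa [show (b : X) = f a from hb] at h
    exact (LinearPMap.mem_graph_iff _).2 ⟨⟨a, a.2, hfa⟩, rfl, congrArg g (Subtype.ext hb.symm)⟩

lemma mem_graph_ofBounded {B : X →L[ℂ] X} {x y : X} : (x, y) ∈ (ofBounded B).graph ↔ B x = y := by
  rw [LinearPMap.mem_graph_iff]
  constructor
  · rintro ⟨a, rfl, h⟩
    exact h
  · intro h
    exact ⟨⟨x, Submodule.mem_top⟩, rfl, h⟩

lemma mem_range_iff_graph {T : X →ₗ.[ℂ] X} {y : X} :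
    y ∈ LinearMap.range T.toFun ↔ ∃ x, (x, y) ∈ T.graph := by
  rw [← LinearPMap.mem_range_iff]
  rfl

/-- The kernel of an unbounded operator, as a subspace of the ambient space. -/
def nullSpace (T : X →ₗ.[ℂ] X) : Submodule ℂ X := (LinearMap.ker T.toFun).map T.domain.subtype

lemma mem_nullSpace {T : X →ₗ.[ℂ] X} {x : X} : x ∈ nullSpace T ↔ (x, 0) ∈ T.graph := by
  rw [LinearPMap.mem_graph_iff]
  constructor
  · rintro ⟨a, ha, rfl⟩
    exact ⟨a, rfl, ha⟩
  · rintro ⟨a, rfl, ha⟩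
    exact ⟨a, ha, rfl⟩

/-- The kernel of `T` is isomorphic to its image in the ambient space. -/
def kerEquivNullSpace (T : X →ₗ.[ℂ] X) : LinearMap.ker T.toFun ≃ₗ[ℂ] nullSpace T :=
  Submodule.equivMapOfInjective _ (Submodule.subtype_injective _) _

lemma isInjective_iff {T : X →ₗ.[ℂ] X} : IsInjective T ↔ nullSpace T = ⊥ :=
  ⟨fun h => by rw [nullSpace, show LinearMap.ker T.toFun = ⊥ from h, Submodule.map_bot],
    fun h => (Submodule.map_injective_of_injective (Submodule.subtype_injective _))
      (h.trans (Submodule.map_bot _).symm)⟩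

lemma isBoundedInverse_iff {T : X →ₗ.[ℂ] X} {R : X →L[ℂ] X} :
    IsBoundedInverse T R ↔ (∀ f, (R f, f) ∈ T.graph) ∧ ∀ u f, (u, f) ∈ T.graph → R f = u := by
  refine and_congr (forall_congr' fun f => ?_) ?_
  · rw [LinearPMap.mem_graph_iff]
    exact ⟨fun ⟨h, e⟩ => ⟨⟨R f, h⟩, rfl, e⟩, fun ⟨y, h, e⟩ => by
      obtain ⟨y, hy⟩ := y
      obtain rfl : y = R f := h
      exact ⟨hy, e⟩⟩
  · constructor
    · rintro h u f hu
      obtain ⟨a, rfl, rfl⟩ := (LinearPMap.mem_graph_iff _).1 hu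
      exact h a
    · exact fun h u => h _ _ (LinearPMap.mem_graph T u)

/-- The adjoint becomes a plain relation between pairs, so later arguments need no domain
bookkeeping. Both directions rest on the density of the domain. -/
lemma mem_graph_adjoint [CompleteSpace X] {C : X →ₗ.[ℂ] X} (hC : Dense (C.domain : Set X)) {y w : X} :
    (y, w) ∈ C.adjoint.graph ↔ ∀ x v, (x, v) ∈ C.graph → inner ℂ y v = inner ℂ w x := by
  constructor
  · intro h x v hx
    obtain ⟨a, rfl, rfl⟩ := (LinearPMap.mem_graph_iff _).1 h
    obtain ⟨b, rfl, rfl⟩ := (LinearPMap.mem_graph_iff _).1 hx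
    exact (LinearPMap.adjoint_isFormalAdjoint hC a b).symm
  · intro h
    have h1 : ∀ x : C.domain, inner ℂ w (x : X) = inner ℂ y (C x) := fun x =>
      (h _ _ (LinearPMap.mem_graph C x)).symm
    have hy := LinearPMap.mem_adjoint_domain_of_exists (T := C) y ⟨w, h1⟩
    exact (LinearPMap.mem_graph_iff _).2
      ⟨⟨y, hy⟩, rfl, LinearPMap.adjoint_apply_eq hC ⟨y, hy⟩ h1⟩

lemma ofBounded_isClosed (B : X →L[ℂ] X) : (ofBounded B).IsClosed := by
  have : ((ofBounded B).graph : Set (X × X)) = {p | B p.1 = p.2} := by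
    ext ⟨x, y⟩
    exact mem_graph_ofBounded
  rw [LinearPMap.IsClosed, this]
  exact isClosed_eq (B.continuous.comp continuous_fst) continuous_snd

/-- A densely defined restriction of a bounded operator is closable, and its closure is that
operator. -/
lemma closure_eq_ofBounded {T : X →ₗ.[ℂ] X} {B : X →L[ℂ] X} (hT : Dense (T.domain : Set X))
    (h : ∀ x y, (x, y) ∈ T.graph → B x = y) : T.IsClosable ∧ T.closure = ofBounded B := by
  have hle : T ≤ ofBounded B := LinearPMap.le_of_le_graph fun ⟨x, y⟩ hxy =>
    mem_graph_ofBounded.2 (h x y hxy)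
  have hcl : T.IsClosable := (ofBounded_isClosed B).isClosable.leIsClosable hle
  refine ⟨hcl, LinearPMap.eq_of_eq_graph ?_⟩
  rw [← hcl.graph_closure_eq_closure_graph]
  refine le_antisymm ?_ ?_
  · exact Submodule.topologicalClosure_minimal _ (LinearPMap.le_graph_of_le hle)
      (ofBounded_isClosed B)
  · rintro ⟨x, y⟩ hxy
    obtain rfl : B x = y := mem_graph_ofBounded.1 hxy
    -- The continuous map `x ↦ (x, B x)` sends the dense domain of `T` into the graph of `T`, hence
    -- every point into its closure.
    have hc : Continuous fun x => (x, B x) := continuous_id.prodMk B.continuous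
    refine hc.closure_preimage_subset _ (closure_mono ?_ (hT x))
    intro z hz
    obtain ⟨w, hw⟩ := LinearPMap.mem_domain_iff.1 hz
    change (z, B z) ∈ T.graph
    rwa [h z w hw]

/-- If `N` is orthogonal to `W` and the quotient by `W` is finite-dimensional, so is `N`. -/
lemma finiteDimensional_of_orthogonal {W N : Submodule ℂ X} [FiniteDimensional ℂ (X ⧸ W)]
    (h : ∀ w ∈ W, ∀ n ∈ N, inner ℂ n w = 0) : FiniteDimensional ℂ N := by
  -- Orthogonality makes `N ∩ W` trivial, so `N` embeds in the quotient by `W`.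
  refine Module.Finite.of_injective (W.mkQ ∘ₗ N.subtype) ?_
  rw [← LinearMap.ker_eq_bot, LinearMap.ker_eq_bot']
  rintro ⟨n, hn⟩ h0
  have hw : n ∈ W := (Submodule.Quotient.mk_eq_zero W).1 h0
  exact Subtype.ext (inner_self_eq_zero.1 (h n hw n hn))

lemma not_finiteDefect_of_orthogonal {T : X →ₗ.[ℂ] X} {N : Submodule ℂ X}
    (hN : ¬ FiniteDimensional ℂ N) (h : ∀ x y, (x, y) ∈ T.graph → ∀ n ∈ N, inner ℂ n y = 0) :
    ¬ FiniteDefect T := by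
  intro hd
  have : FiniteDimensional ℂ (X ⧸ LinearMap.range T.toFun) := hd
  refine hN (finiteDimensional_of_orthogonal (W := LinearMap.range T.toFun) fun w hw n hn => ?_)
  obtain ⟨x, hx⟩ := mem_range_iff_graph.1 hw
  exact h x w hx n hn

lemma finiteNullity_iff {T : X →ₗ.[ℂ] X} :
    FiniteNullity T ↔ FiniteDimensional ℂ (nullSpace T) :=
  Module.Finite.equiv_iff (kerEquivNullSpace T)

lemma IsBoundedInverse.nullSpace_eq_bot {T : X →ₗ.[ℂ] X} {R : X →L[ℂ] X}
    (h : IsBoundedInverse T R) : nullSpace T = ⊥ := by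
  rw [Submodule.eq_bot_iff]
  intro x hx
  rw [← (isBoundedInverse_iff.1 h).2 x 0 (mem_nullSpace.1 hx), map_zero]

/-- An operator with bounded inverse is semi-Fredholm with trivial kernel. -/
lemma IsBoundedInverse.isPhiPlus {T : X →ₗ.[ℂ] X} {R : X →L[ℂ] X} (h : IsBoundedInverse T R) :
    IsPhiPlus T := by
  constructor
  · have : LinearMap.range T.toFun = ⊤ := by
      rw [eq_top_iff]
      exact fun f _ => mem_range_iff_graph.2 ⟨_, (isBoundedInverse_iff.1 h).1 f⟩
    rw [HasClosedRange, this]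
    exact isClosed_univ
  · rw [finiteNullity_iff, h.nullSpace_eq_bot]
    infer_instance

end Graphs

/-! ### Elimination of the second component -/

section SchurComplement

variable {X : Type*} [NormedAddCommGroup X] [InnerProductSpace ℂ X]

lemma smul_mem_graph {T : X →ₗ.[ℂ] X} {x y : X} (r : ℂ) (h : (x, y) ∈ T.graph) :
    (r • x, r • y) ∈ T.graph := T.graph.smul_mem r h

lemma add_mem_graph {T : X →ₗ.[ℂ] X} {x y x' y' : X} (h : (x, y) ∈ T.graph)
    (h' : (x', y') ∈ T.graph) : (x + x', y + y') ∈ T.graph := T.graph.add_mem h h'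

lemma sub_mem_graph {T : X →ₗ.[ℂ] X} {x y x' y' : X} (h : (x, y) ∈ T.graph)
    (h' : (x', y') ∈ T.graph) : (x - x', y - y') ∈ T.graph := T.graph.sub_mem h h'

/-- A right inverse of an injective operator is two-sided; afterwards only the equation `T (R f) =
f` has to be verified. -/
lemma isBoundedInverse_of_nullSpace {T : X →ₗ.[ℂ] X} {R : X →L[ℂ] X}
    (h : ∀ f, (R f, f) ∈ T.graph) (h0 : nullSpace T = ⊥) : IsBoundedInverse T R := by
  refine isBoundedInverse_iff.2 ⟨h, fun u f hu => ?_⟩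
  have h1 := sub_mem_graph (h f) hu
  rw [sub_self] at h1
  have h2 := mem_nullSpace.2 h1
  rw [h0, Submodule.mem_bot] at h2
  exact sub_eq_zero.1 h2

/-- The operator `C ν C₀ - ω (ω ε + i σ)` on its maximal domain. -/
def schurOp (C C₀ : X →ₗ.[ℂ] X) (ε ν σ : X →L[ℂ] X) (ω : ℂ) : X →ₗ.[ℂ] X where
  domain := (comp C (ν.toLinearMap.compPMap C₀)).domain
  toFun := (comp C (ν.toLinearMap.compPMap C₀)).toFun
    - (ω • (ω • ε + Complex.I • σ)).toLinearMap ∘ₗ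
        (comp C (ν.toLinearMap.compPMap C₀)).domain.subtype

/-- The embedding of the first summand. -/
def inlOp : X →L[ℂ] WithLp 2 (X × X) :=
  (WithLp.prodContinuousLinearEquiv 2 ℂ X X).symm.toContinuousLinearMap ∘L
    ContinuousLinearMap.inl ℂ X X

/-- The embedding of the second summand. -/
def inrOp : X →L[ℂ] WithLp 2 (X × X) :=
  (WithLp.prodContinuousLinearEquiv 2 ℂ X X).symm.toContinuousLinearMap ∘L
    ContinuousLinearMap.inr ℂ X X

lemma inlOp_apply (x : X) : inlOp x = WithLp.toLp 2 (x, 0) := rfl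

lemma inrOp_apply (x : X) : inrOp x = WithLp.toLp 2 (0, x) := rfl

lemma inlOp_add_inrOp (x y : X) : inlOp x + inrOp y = WithLp.toLp 2 (x, y) := by
  rw [inlOp_apply, inrOp_apply, ← WithLp.toLp_add, Prod.mk_add_mk, add_zero, zero_add]

variable {C C₀ : X →ₗ.[ℂ] X} {ε μ ν σ : X →L[ℂ] X} {ω : ℂ}

lemma mem_graph_systemOp {z w : WithLp 2 (X × X)} :
    (z, w) ∈ (systemOp C C₀ ε μ σ ω).graph ↔
      ∃ a b, (z.fst, a) ∈ C₀.graph ∧ (z.snd, b) ∈ C.graph ∧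
        w.fst = -Complex.I • σ z.fst + Complex.I • b - ω • ε z.fst ∧
        w.snd = -Complex.I • a - ω • μ z.snd := by
  rw [LinearPMap.mem_graph_iff]
  constructor
  · rintro ⟨y, rfl, rfl⟩
    exact ⟨_, _, LinearPMap.mem_graph C₀ ⟨y.1.fst, y.2.1⟩, LinearPMap.mem_graph C ⟨y.1.snd, y.2.2⟩,
      rfl, rfl⟩
  · rintro ⟨a, b, ha, hb, h1, h2⟩
    obtain ⟨p, hp, rfl⟩ := (LinearPMap.mem_graph_iff _).1 ha
    obtain ⟨q, hq, rfl⟩ := (LinearPMap.mem_graph_iff _).1 hb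
    have hp' : (p : X) = z.fst := hp
    have hq' : (q : X) = z.snd := hq
    have hz : z.fst ∈ C₀.domain ∧ z.snd ∈ C.domain := ⟨hp' ▸ p.2, hq' ▸ q.2⟩
    refine ⟨⟨z, hz⟩, rfl, ?_⟩
    have e1 : p = ⟨z.fst, hz.1⟩ := Subtype.ext hp'
    have e2 : q = ⟨z.snd, hz.2⟩ := Subtype.ext hq'
    subst e1 e2
    refine (WithLp.ofLp_injective 2) (Prod.ext ?_ ?_)
    · exact h1.symm
    · exact h2.symm

lemma mem_graph_compPMap {x y : X} :
    (x, y) ∈ (ν.toLinearMap.compPMap C₀).graph ↔ ∃ a, (x, a) ∈ C₀.graph ∧ ν a = y := by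
  rw [LinearPMap.mem_graph_iff]
  constructor
  · rintro ⟨u, rfl, rfl⟩
    exact ⟨_, LinearPMap.mem_graph C₀ u, rfl⟩
  · rintro ⟨a, ha, rfl⟩
    obtain ⟨u, rfl, rfl⟩ := (LinearPMap.mem_graph_iff _).1 ha
    exact ⟨u, rfl, rfl⟩

lemma mem_graph_schurOp {E f : X} :
    (E, f) ∈ (schurOp C C₀ ε ν σ ω).graph ↔
      ∃ a b, (E, a) ∈ C₀.graph ∧ (ν a, b) ∈ C.graph ∧
        f = b - ω • (ω • ε E + Complex.I • σ E) := by
  have key : (E, f) ∈ (schurOp C C₀ ε ν σ ω).graph ↔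
      (E, f + ω • (ω • ε E + Complex.I • σ E)) ∈
        (comp C (ν.toLinearMap.compPMap C₀)).graph := by
    rw [LinearPMap.mem_graph_iff, LinearPMap.mem_graph_iff]
    refine exists_congr fun y => and_congr_right fun hy => ?_
    have hy' : (y : X) = E := hy
    subst hy'
    exact sub_eq_iff_eq_add
  rw [key, mem_graph_comp]
  constructor
  · rintro ⟨v, hv, h⟩
    obtain ⟨a, ha, rfl⟩ := mem_graph_compPMap.1 hv
    exact ⟨a, _, ha, h, (add_sub_cancel_right _ _).symm⟩
  · rintro ⟨a, b, ha, hb, rfl⟩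
    exact ⟨ν a, mem_graph_compPMap.2 ⟨a, ha, rfl⟩, by rwa [sub_add_cancel]⟩

/-- Eliminating the second component of the system. -/
lemma schurOp_of_systemOp (hν : ∀ x, ν (μ x) = x) {z w : WithLp 2 (X × X)}
    (h : (z, w) ∈ (systemOp C C₀ ε μ σ ω).graph) (hw : w.snd = 0) :
    (z.fst, ω • w.fst) ∈ (schurOp C C₀ ε ν σ ω).graph := by
  obtain ⟨a, b, ha, hb, h1, h2⟩ := mem_graph_systemOp.1 h
  have h3 : ν a = (Complex.I * ω) • z.snd := by
    have h4 : a = (Complex.I * ω) • μ z.snd := by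
      have h5 : -Complex.I • a = ω • μ z.snd := by rw [← sub_eq_zero, ← h2, hw]
      calc a = Complex.I • (-Complex.I • a) := by
            rw [smul_smul, mul_neg, Complex.I_mul_I, neg_neg, one_smul]
        _ = _ := by rw [h5, smul_smul]
    rw [h4, map_smul, hν]
  refine mem_graph_schurOp.2 ⟨a, (Complex.I * ω) • b, ha, h3 ▸ smul_mem_graph _ hb, ?_⟩
  rw [h1]
  module

/-- The second component is dictated by `-i a - ω μ H = 0`, whose solution is `H = -i ω⁻¹ ν a`. -/
lemma systemOp_of_schurOp (hω : ω ≠ 0) (hμ : ∀ x, μ (ν x) = x) {E a b : X}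
    (ha : (E, a) ∈ C₀.graph) (hb : (ν a, b) ∈ C.graph) :
    (WithLp.toLp 2 (E, -(Complex.I * ω⁻¹) • ν a),
      WithLp.toLp 2 (ω⁻¹ • (b - ω • (ω • ε E + Complex.I • σ E)), 0)) ∈
        (systemOp C C₀ ε μ σ ω).graph := by
  refine mem_graph_systemOp.2 ⟨a, -(Complex.I * ω⁻¹) • b, ha, smul_mem_graph _ hb, ?_, ?_⟩
  · have hI : Complex.I • (-(Complex.I * ω⁻¹) • b) = ω⁻¹ • b := by
      rw [smul_smul]
      congr 1
      linear_combination (-ω⁻¹) * Complex.I_mul_I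
    change ω⁻¹ • (b - ω • (ω • ε E + Complex.I • σ E))
      = -Complex.I • σ E + Complex.I • (-(Complex.I * ω⁻¹) • b) - ω • ε E
    rw [hI, smul_sub, inv_smul_smul₀ hω]
    module
  · change (0 : X) = -Complex.I • a - ω • μ (-(Complex.I * ω⁻¹) • ν a)
    rw [map_smul, hμ, smul_smul, ← sub_smul]
    have h0 : -Complex.I - ω * -(Complex.I * ω⁻¹) = 0 := by
      field_simp
      ring
    rw [h0, zero_smul]

lemma nullSpace_schurOp (hω : ω ≠ 0) (hν : ∀ x, ν (μ x) = x) (hμ : ∀ x, μ (ν x) = x) :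
    (nullSpace (systemOp C C₀ ε μ σ ω)).map (WithLp.fstₗ 2 ℂ X X)
      = nullSpace (schurOp C C₀ ε ν σ ω) := by
  ext E
  rw [Submodule.mem_map, mem_nullSpace]
  constructor
  · rintro ⟨z, hz, rfl⟩
    have := schurOp_of_systemOp hν (mem_nullSpace.1 hz) rfl
    simpa using this
  · intro hE
    obtain ⟨a, b, ha, hb, h⟩ := mem_graph_schurOp.1 hE
    have h1 := systemOp_of_schurOp (ε := ε) (σ := σ) hω hμ ha hb
    rw [← h, smul_zero] at h1
    exact ⟨WithLp.toLp 2 (E, -(Complex.I * ω⁻¹) • ν a), mem_nullSpace.2 h1, rfl⟩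

/-- Once `E = 0`, the second equation reduces to `ω μ H = 0`, and `μ` is injective. -/
lemma fst_injOn_nullSpace (hω : ω ≠ 0) (hν : ∀ x, ν (μ x) = x) {z : WithLp 2 (X × X)}
    (hz : z ∈ nullSpace (systemOp C C₀ ε μ σ ω)) (h : z.fst = 0) : z = 0 := by
  have hz' : (z, (0 : WithLp 2 (X × X))) ∈ (systemOp C C₀ ε μ σ ω).graph := mem_nullSpace.1 hz
  obtain ⟨a, b, ha, -, -, h2⟩ := mem_graph_systemOp.1 hz'
  rw [h] at ha
  have ha0 : a = 0 := LinearPMap.graph_fst_eq_zero_snd C₀ ha rfl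
  have h3 : μ z.snd = 0 := by
    rw [WithLp.zero_snd, ha0, smul_zero, zero_sub, eq_comm, neg_eq_zero] at h2
    exact (smul_eq_zero.1 h2).resolve_left hω
  have h5 : z.snd = 0 := by rw [← hν z.snd, h3, map_zero]
  exact (WithLp.ofLp_injective 2) (Prod.ext h h5)

/-- The kernels of the system and of its Schur complement are isomorphic. -/
lemma nonempty_nullSpace_equiv (hω : ω ≠ 0) (hν : ∀ x, ν (μ x) = x) (hμ : ∀ x, μ (ν x) = x) :
    Nonempty (nullSpace (systemOp C C₀ ε μ σ ω) ≃ₗ[ℂ] nullSpace (schurOp C C₀ ε ν σ ω)) := by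
  set N := nullSpace (systemOp C C₀ ε μ σ ω) with hN
  let g := (WithLp.fstₗ 2 ℂ X X).domRestrict N
  have hg : Function.Injective g := by
    rw [← LinearMap.ker_eq_bot, LinearMap.ker_eq_bot']
    intro z hz
    exact Subtype.ext (fst_injOn_nullSpace hω hν z.2 hz)
  refine ⟨(LinearEquiv.ofInjective g hg).trans (LinearEquiv.ofEq _ _ ?_)⟩
  rw [← nullSpace_schurOp hω hν hμ, LinearMap.range_domRestrict]

end SchurComplement

/-! ### A coercive auxiliary problem on the graph of `C` -/

section Auxiliary

variable {X : Type*} [NormedAddCommGroup X] [InnerProductSpace ℂ X] [CompleteSpace X]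
variable {C : X →ₗ.[ℂ] X} {μ : X →L[ℂ] X}

/-- By the Lax-Milgram theorem on the graph of `C`, the system `E = C H + f`, `C* E + μ H = g` has
a unique solution, which depends continuously on `f` and `g`. -/
theorem exists_auxiliary_solution (hC : Dense (C.domain : Set X)) (hcl : C.IsClosed) {m : ℝ}
    (hm : 0 < m) (hμ : ∀ x, m * ‖x‖ ^ 2 ≤ (inner ℂ (μ x) x).re) :
    ∃ P Q : X × X →L[ℂ] X,
      (∀ f g, (Q (f, g), P (f, g) - f) ∈ C.graph ∧
        (P (f, g), g - μ (Q (f, g))) ∈ C.adjoint.graph) ∧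
      ∀ f g E H, (H, E - f) ∈ C.graph → (E, g - μ H) ∈ C.adjoint.graph →
        E = P (f, g) ∧ H = Q (f, g) := by
  let e := WithLp.prodContinuousLinearEquiv 2 ℂ X X
  let G : Submodule ℂ (WithLp 2 (X × X)) := C.graph.comap e.toLinearMap
  have hG : IsClosed (G : Set (WithLp 2 (X × X))) := hcl.preimage e.continuous
  have : CompleteSpace G := hG.completeSpace_coe
  -- `A` represents on the graph the form `⟨μ H, x⟩ + ⟨C H, C x⟩`, as the compression of `diag(μ,
  -- 1)`.
  let A : G →L[ℂ] G := G.orthogonalProjectionOnto ∘L blockOp μ 0 0 1 ∘L G.subtypeL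
  have hA : ∀ u w : G, inner ℂ (A u) w
      = inner ℂ (μ u.1.fst) w.1.fst + inner ℂ u.1.snd w.1.snd := by
    intro u w
    have h1 : inner ℂ (A u) w = inner ℂ (blockOp μ 0 0 1 u.1) w.1 := by
      rw [Submodule.coe_inner]
      exact Submodule.inner_orthogonalProjectionOnto_eq_of_mem_right w _
    rw [h1, WithLp.prod_inner_apply]
    simp [blockOp]
  have hunit : IsUnit A := by
    -- Coercivity in the graph norm: `m` controls the first component and `1` the second.
    refine ContinuousLinearMap.isUnit_of_forall_le_norm_inner_map A
      (c := ⟨min m 1, (lt_min hm one_pos).le⟩) (lt_min hm one_pos) fun u => ?_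
    refine le_trans ?_ (Complex.re_le_norm _)
    have h1 : ‖u‖ ^ 2 = ‖u.1.fst‖ ^ 2 + ‖u.1.snd‖ ^ 2 := WithLp.prod_norm_sq_eq_of_L2 _
    have h2 : (inner ℂ u.1.snd u.1.snd).re = ‖u.1.snd‖ ^ 2 := inner_self_eq_norm_sq (𝕜 := ℂ) _
    rw [hA, Complex.add_re, h2, h1]
    change _ * min m 1 ≤ _
    have h3 := hμ u.1.fst
    nlinarith [sq_nonneg ‖u.1.fst‖, sq_nonneg ‖u.1.snd‖, min_le_left m 1, min_le_right m 1]
  obtain ⟨U, hU⟩ := hunit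
  let B : G →L[ℂ] G := ↑U⁻¹
  have hAB : ∀ x, A (B x) = x := fun x => by
    have h1 : (U : G →L[ℂ] G) * B = 1 := U.mul_inv
    rw [hU] at h1
    exact DFunLike.congr_fun h1 x
  -- The functional `⟨g, x⟩ - ⟨f, C x⟩` is represented by `(g, -f)`. The solution `S (f, g)` is a
  -- pair `(H, C H)`, from which `E = C H + f` is recovered.
  let J : X × X →L[ℂ] WithLp 2 (X × X) := e.symm.toContinuousLinearMap ∘L
    ((ContinuousLinearMap.snd ℂ X X).prod (-ContinuousLinearMap.fst ℂ X X))
  let S : X × X →L[ℂ] WithLp 2 (X × X) := G.subtypeL ∘L B ∘L G.orthogonalProjectionOnto ∘L J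
  let P : X × X →L[ℂ] X := WithLp.sndL 2 ℂ X X ∘L S + ContinuousLinearMap.fst ℂ X X
  let Q : X × X →L[ℂ] X := WithLp.fstL 2 ℂ X X ∘L S
  have hsol : ∀ f g, (Q (f, g), P (f, g) - f) ∈ C.graph ∧
      (P (f, g), g - μ (Q (f, g))) ∈ C.adjoint.graph := by
    intro f g
    have hP : P (f, g) = (S (f, g)).snd + f := rfl
    have hQ : Q (f, g) = (S (f, g)).fst := rfl
    constructor
    · rw [hP, hQ, add_sub_cancel_right]
      exact (B (G.orthogonalProjectionOnto (J (f, g)))).2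
    -- The variational identity, tested on all pairs of the graph, is exactly the statement that `C*
    -- E = g - μ H`.
    · refine (mem_graph_adjoint hC).2 fun x v hxv => ?_
      have h1 := hA (B (G.orthogonalProjectionOnto (J (f, g)))) ⟨WithLp.toLp 2 (x, v), hxv⟩
      rw [hAB, Submodule.inner_orthogonalProjectionOnto_eq_of_mem_right,
        WithLp.prod_inner_apply] at h1
      have h2 : inner ℂ g x + inner ℂ (-f) v
        = inner ℂ (μ (S (f, g)).fst) x + inner ℂ (S (f, g)).snd v := h1
      rw [inner_neg_left] at h2
      rw [hP, hQ, inner_add_left, inner_sub_left]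
      linear_combination -h2
  refine ⟨P, Q, hsol, fun f g E H h1 h2 => ?_⟩
  -- The differences `E'`, `H'` of two solutions satisfy `E' = C H'` and `C* E' = -μ H'`, so `‖E'‖²
  -- = -⟨μ H', H'⟩`, and coercivity forces both to vanish.
  have h3 := sub_mem_graph h1 (hsol f g).1
  have h4 := sub_mem_graph h2 (hsol f g).2
  rw [sub_sub_sub_cancel_right] at h3
  rw [sub_sub_sub_cancel_left, ← map_sub, ← neg_sub H, map_neg] at h4
  have h5 := (mem_graph_adjoint hC).1 h4 _ _ h3
  rw [inner_neg_left] at h5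
  have h6 := congrArg Complex.re h5
  rw [Complex.neg_re] at h6
  have h7 : (inner ℂ (E - P (f, g)) (E - P (f, g))).re = ‖E - P (f, g)‖ ^ 2 :=
    inner_self_eq_norm_sq (𝕜 := ℂ) _
  have h8 := hμ (H - Q (f, g))
  have h9 : ‖E - P (f, g)‖ ^ 2 + m * ‖H - Q (f, g)‖ ^ 2 ≤ 0 := by linarith
  have h10 : 0 ≤ m * ‖H - Q (f, g)‖ ^ 2 := by positivity
  constructor
  · have : ‖E - P (f, g)‖ ^ 2 = 0 := le_antisymm (by linarith) (sq_nonneg _)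
    exact sub_eq_zero.1 (norm_eq_zero.1 (pow_eq_zero_iff two_ne_zero |>.1 this))
  · have : m * ‖H - Q (f, g)‖ ^ 2 = 0 :=
      le_antisymm (by linarith [sq_nonneg ‖E - P (f, g)‖]) h10
    have := (mul_eq_zero.1 this).resolve_left hm.ne'
    exact sub_eq_zero.1 (norm_eq_zero.1 (pow_eq_zero_iff two_ne_zero |>.1 this))

end Auxiliary

/-! ### Kernels and ranges of the system and its Schur complement -/

section Equivalence

variable {X : Type*} [NormedAddCommGroup X] [InnerProductSpace ℂ X] [CompleteSpace X]

/-- `C` is closed and densely defined, and `μ` is coercive with inverse `ν`. -/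
structure IsAdmissible (C : X →ₗ.[ℂ] X) (μ ν : X →L[ℂ] X) : Prop where
  dense : Dense (C.domain : Set X)
  closed : C.IsClosed
  coercive : ∃ m : ℝ, 0 < m ∧ ∀ x, m * ‖x‖ ^ 2 ≤ (inner ℂ (μ x) x).re
  left_inv : ∀ x, ν (μ x) = x
  right_inv : ∀ x, μ (ν x) = x

variable {C : X →ₗ.[ℂ] X} {ε μ ν σ : X →L[ℂ] X} {ω : ℂ}

/-- The second equation of the system can be solved boundedly. -/
lemma IsAdmissible.exists_bounded_solution (h : IsAdmissible C μ ν) (ε σ : X →L[ℂ] X)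
    (hω : ω ≠ 0) :
    ∃ (K : X →L[ℂ] X) (S : X →L[ℂ] WithLp 2 (X × X)), ∀ g,
      (S g, WithLp.toLp 2 (K g, g)) ∈ (systemOp C C.adjoint ε μ σ ω).graph := by
  obtain ⟨m, hm, hμ⟩ := h.coercive
  obtain ⟨P, Q, hPQ, -⟩ := exists_auxiliary_solution h.dense h.closed hm hμ
  let J : X →L[ℂ] X × X := Complex.I • ContinuousLinearMap.inr ℂ X X
  have hJ : ∀ g, J g = (0, Complex.I • g) := fun g => by simp [J]
  -- Take `E = C H'` and `C* E + μ H' = i g`, and put `H = i ω⁻¹ H'`. The terms in `μ H'` cancel in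
  -- the second equation. In the first, `i C H = -ω⁻¹ E` is bounded in `g`, which makes `K` bounded
  -- although `C` is not.
  refine ⟨(-Complex.I • σ - ω⁻¹ • 1 - ω • ε) ∘L P ∘L J,
    inlOp ∘L P ∘L J + inrOp ∘L ((Complex.I * ω⁻¹) • Q) ∘L J, fun g => ?_⟩
  obtain ⟨h1, h2⟩ := hPQ 0 (Complex.I • g)
  rw [sub_zero] at h1
  have hS : (inlOp ∘L P ∘L J + inrOp ∘L ((Complex.I * ω⁻¹) • Q) ∘L J) g
      = WithLp.toLp 2 (P (0, Complex.I • g), (Complex.I * ω⁻¹) • Q (0, Complex.I • g)) := by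
    rw [← hJ, ← inlOp_add_inrOp]
    rfl
  rw [hS]
  refine mem_graph_systemOp.2 ⟨_, _, h2, smul_mem_graph (Complex.I * ω⁻¹) h1, ?_, ?_⟩
  · have hI : Complex.I • ((Complex.I * ω⁻¹) • P (0, Complex.I • g))
        = -(ω⁻¹ • P (0, Complex.I • g)) := by
      rw [smul_smul, ← mul_assoc, Complex.I_mul_I, neg_one_mul, neg_smul]
    change -Complex.I • σ (P (J g)) - ω⁻¹ • P (J g) - ω • ε (P (J g))
      = -Complex.I • σ (P (0, Complex.I • g))
        + Complex.I • ((Complex.I * ω⁻¹) • P (0, Complex.I • g)) - ω • ε (P (0, Complex.I • g))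
    rw [hI, hJ, ← sub_eq_add_neg]
  · change g = -Complex.I • (Complex.I • g - μ (Q (0, Complex.I • g)))
      - ω • μ ((Complex.I * ω⁻¹) • Q (0, Complex.I • g))
    rw [map_smul, smul_sub, smul_smul, smul_smul]
    have e1 : -Complex.I * Complex.I = 1 := by rw [neg_mul, Complex.I_mul_I, neg_neg]
    have e2 : ω * (Complex.I * ω⁻¹) = Complex.I := by field_simp
    rw [e1, e2]
    module

lemma range_schurOp (h : IsAdmissible C μ ν) (hω : ω ≠ 0) {f : X} :
    WithLp.toLp 2 (f, (0 : X)) ∈ LinearMap.range (systemOp C C.adjoint ε μ σ ω).toFun ↔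
      f ∈ LinearMap.range (schurOp C C.adjoint ε ν σ ω).toFun := by
  constructor
  · intro hf
    obtain ⟨z, hz⟩ := mem_range_iff_graph.1 hf
    have h1 := smul_mem_graph ω⁻¹ (schurOp_of_systemOp h.left_inv hz rfl)
    rw [inv_smul_smul₀ hω] at h1
    exact mem_range_iff_graph.2 ⟨_, h1⟩
  · intro hf
    obtain ⟨E, hE⟩ := mem_range_iff_graph.1 hf
    obtain ⟨a, b, ha, hb, h1⟩ := mem_graph_schurOp.1 hE
    have h2 := systemOp_of_schurOp (ε := ε) (σ := σ) hω h.right_inv ha hb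
    rw [← h1] at h2
    have h3 := smul_mem_graph ω h2
    rw [← WithLp.toLp_smul, ← WithLp.toLp_smul, Prod.smul_mk, Prod.smul_mk, smul_inv_smul₀ hω,
      smul_zero] at h3
    exact mem_range_iff_graph.2 ⟨_, h3⟩

/-- The range of the system is the preimage of the range of its Schur complement under a bounded
surjection. -/
lemma IsAdmissible.exists_range_eq_comap (h : IsAdmissible C μ ν) (ε σ : X →L[ℂ] X)
    (hω : ω ≠ 0) :
    ∃ Φ : WithLp 2 (X × X) →L[ℂ] X, (∀ f, Φ (inlOp f) = f) ∧
      LinearMap.range (systemOp C C.adjoint ε μ σ ω).toFun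
        = (LinearMap.range (schurOp C C.adjoint ε ν σ ω).toFun).comap Φ.toLinearMap := by
  obtain ⟨K, S, hS⟩ := h.exists_bounded_solution ε σ hω
  -- `Φ (f, g) = f - K g`: modulo the range, `(f, g)` agrees with `(f - K g, 0)`.
  refine ⟨WithLp.fstL 2 ℂ X X - K ∘L WithLp.sndL 2 ℂ X X, fun f => ?_, ?_⟩
  · change f - K 0 = f
    rw [map_zero, sub_zero]
  · ext z
    have h1 : z - WithLp.toLp 2 (K z.snd, z.snd) = WithLp.toLp 2 (z.fst - K z.snd, 0) :=
      (WithLp.ofLp_injective 2) (Prod.ext rfl (sub_self z.snd))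
    have h2 : WithLp.toLp 2 (K z.snd, z.snd) ∈
        LinearMap.range (systemOp C C.adjoint ε μ σ ω).toFun :=
      mem_range_iff_graph.2 ⟨_, hS z.snd⟩
    rw [← Submodule.sub_mem_iff_left _ h2, h1, range_schurOp h hω]
    rfl

/-! ### Transfer of Fredholm properties -/

section Transfer

lemma IsAdmissible.isInjective_iff (h : IsAdmissible C μ ν) (ε σ : X →L[ℂ] X) (hω : ω ≠ 0) :
    IsInjective (systemOp C C.adjoint ε μ σ ω) ↔ IsInjective (schurOp C C.adjoint ε ν σ ω) := by
  obtain ⟨e⟩ := nonempty_nullSpace_equiv (C := C) (C₀ := C.adjoint) (ε := ε) (σ := σ) hω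
    h.left_inv h.right_inv
  rw [Maxwell.isInjective_iff, Maxwell.isInjective_iff, ← Submodule.subsingleton_iff_eq_bot,
    ← Submodule.subsingleton_iff_eq_bot]
  exact e.toEquiv.subsingleton_congr

/-- Since `Φ ∘ inlOp` is the identity, each of the two ranges is a preimage of the other under a
continuous map. -/
lemma IsAdmissible.hasClosedRange_iff (h : IsAdmissible C μ ν) (ε σ : X →L[ℂ] X) (hω : ω ≠ 0) :
    HasClosedRange (systemOp C C.adjoint ε μ σ ω)
      ↔ HasClosedRange (schurOp C C.adjoint ε ν σ ω) := by
  obtain ⟨Φ, hΦ, hr⟩ := h.exists_range_eq_comap ε σ hω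
  rw [HasClosedRange, HasClosedRange, hr]
  constructor
  · intro hc
    convert hc.preimage (inlOp (X := X)).continuous using 1
    ext f
    change f ∈ LinearMap.range _ ↔ Φ (inlOp f) ∈ LinearMap.range _
    rw [hΦ]
  · exact fun hc => hc.preimage Φ.continuous

/-- Density is pushed forward by the continuous surjection `Φ` and pulled back because `Φ` is open.
-/
lemma IsAdmissible.hasDenseRange_iff (h : IsAdmissible C μ ν) (ε σ : X →L[ℂ] X) (hω : ω ≠ 0) :
    HasDenseRange (systemOp C C.adjoint ε μ σ ω)
      ↔ HasDenseRange (schurOp C C.adjoint ε ν σ ω) := by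
  obtain ⟨Φ, hΦ, hr⟩ := h.exists_range_eq_comap ε σ hω
  have hsurj : Function.Surjective Φ := fun f => ⟨_, hΦ f⟩
  rw [HasDenseRange, HasDenseRange, hr]
  constructor
  · intro hc
    refine (hsurj.denseRange.dense_image Φ.continuous hc).mono ?_
    rintro _ ⟨z, hz, rfl⟩
    exact hz
  · exact fun hc => hc.preimage (Φ.isOpenMap hsurj)

lemma IsAdmissible.nonempty_quotient_equiv (h : IsAdmissible C μ ν) (ε σ : X →L[ℂ] X)
    (hω : ω ≠ 0) :
    Nonempty ((WithLp 2 (X × X) ⧸ LinearMap.range (systemOp C C.adjoint ε μ σ ω).toFun) ≃ₗ[ℂ]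
      X ⧸ LinearMap.range (schurOp C C.adjoint ε ν σ ω).toFun) := by
  obtain ⟨Φ, hΦ, hr⟩ := h.exists_range_eq_comap ε σ hω
  set W := LinearMap.range (schurOp C C.adjoint ε ν σ ω).toFun
  let q := W.mkQ ∘ₗ Φ.toLinearMap
  have hq : Function.Surjective q :=
    (Submodule.mkQ_surjective W).comp fun f => ⟨_, hΦ f⟩
  have hk : LinearMap.range (systemOp C C.adjoint ε μ σ ω).toFun = LinearMap.ker q := by
    rw [hr, LinearMap.ker_comp, Submodule.ker_mkQ]
  exact ⟨(Submodule.quotEquivOfEq _ _ hk).trans (q.quotKerEquivOfSurjective hq)⟩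

lemma IsAdmissible.finiteNullity_iff (h : IsAdmissible C μ ν) (ε σ : X →L[ℂ] X) (hω : ω ≠ 0) :
    FiniteNullity (systemOp C C.adjoint ε μ σ ω)
      ↔ FiniteNullity (schurOp C C.adjoint ε ν σ ω) := by
  obtain ⟨e⟩ := nonempty_nullSpace_equiv (C := C) (C₀ := C.adjoint) (ε := ε) (σ := σ) hω
    h.left_inv h.right_inv
  rw [Maxwell.finiteNullity_iff, Maxwell.finiteNullity_iff]
  exact Module.Finite.equiv_iff e

lemma IsAdmissible.finiteDefect_iff (h : IsAdmissible C μ ν) (ε σ : X →L[ℂ] X) (hω : ω ≠ 0) :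
    FiniteDefect (systemOp C C.adjoint ε μ σ ω)
      ↔ FiniteDefect (schurOp C C.adjoint ε ν σ ω) := by
  obtain ⟨e⟩ := h.nonempty_quotient_equiv ε σ hω
  exact Module.Finite.equiv_iff e

lemma IsAdmissible.isPhiPlus_iff (h : IsAdmissible C μ ν) (ε σ : X →L[ℂ] X) (hω : ω ≠ 0) :
    IsPhiPlus (systemOp C C.adjoint ε μ σ ω) ↔ IsPhiPlus (schurOp C C.adjoint ε ν σ ω) :=
  and_congr (h.hasClosedRange_iff ε σ hω) (h.finiteNullity_iff ε σ hω)

lemma IsAdmissible.isPhiMinus_iff (h : IsAdmissible C μ ν) (ε σ : X →L[ℂ] X) (hω : ω ≠ 0) :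
    IsPhiMinus (systemOp C C.adjoint ε μ σ ω) ↔ IsPhiMinus (schurOp C C.adjoint ε ν σ ω) :=
  and_congr (h.hasClosedRange_iff ε σ hω) (h.finiteDefect_iff ε σ hω)

lemma IsAdmissible.isFredholm_iff (h : IsAdmissible C μ ν) (ε σ : X →L[ℂ] X) (hω : ω ≠ 0) :
    IsFredholm (systemOp C C.adjoint ε μ σ ω) ↔ IsFredholm (schurOp C C.adjoint ε ν σ ω) :=
  and_congr (h.isPhiPlus_iff ε σ hω) (h.isPhiMinus_iff ε σ hω)

lemma IsAdmissible.isFredholmIndexZero_iff (h : IsAdmissible C μ ν) (ε σ : X →L[ℂ] X)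
    (hω : ω ≠ 0) :
    IsFredholmIndexZero (systemOp C C.adjoint ε μ σ ω)
      ↔ IsFredholmIndexZero (schurOp C C.adjoint ε ν σ ω) := by
  obtain ⟨e⟩ := nonempty_nullSpace_equiv (C := C) (C₀ := C.adjoint) (ε := ε) (σ := σ) hω
    h.left_inv h.right_inv
  obtain ⟨e'⟩ := h.nonempty_quotient_equiv ε σ hω
  refine and_congr (h.isFredholm_iff ε σ hω) ?_
  rw [(kerEquivNullSpace _).finrank_eq, e.finrank_eq, e'.finrank_eq,
    (kerEquivNullSpace (schurOp C C.adjoint ε ν σ ω)).finrank_eq]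

end Transfer

/-! ### Bounded inverses and the block formula -/

section Resolvent

/-- A bounded inverse of the system yields one of the Schur complement. -/
lemma IsAdmissible.isBoundedInverse_schurOp (h : IsAdmissible C μ ν) (hω : ω ≠ 0)
    {Q : WithLp 2 (X × X) →L[ℂ] WithLp 2 (X × X)}
    (hQ : IsBoundedInverse (systemOp C C.adjoint ε μ σ ω) Q) :
    IsBoundedInverse (schurOp C C.adjoint ε ν σ ω)
      (ω⁻¹ • (WithLp.fstL 2 ℂ X X ∘L Q ∘L inlOp)) := by
  refine isBoundedInverse_of_nullSpace (fun f => ?_) ?_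
  · have h1 := (isBoundedInverse_iff.1 hQ).1 (inlOp f)
    have h2 := smul_mem_graph ω⁻¹ (schurOp_of_systemOp h.left_inv h1 rfl)
    rw [inv_smul_smul₀ hω] at h2
    exact h2
  · rw [← Maxwell.isInjective_iff, ← h.isInjective_iff ε σ hω, Maxwell.isInjective_iff]
    exact hQ.nullSpace_eq_bot

/-- A bounded inverse of the Schur complement yields one of the system. -/
lemma IsAdmissible.exists_isBoundedInverse_systemOp (h : IsAdmissible C μ ν) (hω : ω ≠ 0)
    {R : X →L[ℂ] X} (hR : IsBoundedInverse (schurOp C C.adjoint ε ν σ ω) R) :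
    ∃ Q, IsBoundedInverse (systemOp C C.adjoint ε μ σ ω) Q := by
  obtain ⟨m, hm, hμ⟩ := h.coercive
  obtain ⟨P, Q, -, huniq⟩ := exists_auxiliary_solution h.dense h.closed hm hμ
  obtain ⟨K, S, hS⟩ := h.exists_bounded_solution ε σ hω
  -- With `E = R f`, the vector `F f` equals `C ν C* E + E`. Therefore `E` and `-ν C* E` solve the
  -- auxiliary system with data `(F f, 0)`, and uniqueness shows that `ν C* E = -Q (F f, 0)` is
  -- bounded in `f`.
  let F : X →L[ℂ] X := 1 + (ω • (ω • ε + Complex.I • σ) + 1) ∘L R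
  let T : X →L[ℂ] WithLp 2 (X × X) :=
    inlOp ∘L R + inrOp ∘L ((Complex.I * ω⁻¹) • (Q ∘L ContinuousLinearMap.inl ℂ X X ∘L F))
  have hT : ∀ f, (T (ω • f), inlOp f) ∈ (systemOp C C.adjoint ε μ σ ω).graph := by
    intro f
    have hE := (isBoundedInverse_iff.1 hR).1 (ω • f)
    obtain ⟨a, b, ha, hb, h1⟩ := mem_graph_schurOp.1 hE
    have h2 := systemOp_of_schurOp (ε := ε) (σ := σ) hω h.right_inv ha hb
    rw [← h1, inv_smul_smul₀ hω] at h2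
    have hF : F (ω • f) = b + R (ω • f) := by
      change ω • f + (ω • (ω • ε (R (ω • f)) + Complex.I • σ (R (ω • f))) + R (ω • f)) = _
      nth_rewrite 1 [h1]
      abel
    have h3 := (huniq (F (ω • f)) 0 (R (ω • f)) (-ν a) ?_ ?_).2
    · have hTf : T (ω • f) = WithLp.toLp 2 (R (ω • f), -(Complex.I * ω⁻¹) • ν a) := by
        change inlOp (R (ω • f)) + inrOp ((Complex.I * ω⁻¹) • Q (F (ω • f), 0)) = _
        rw [← h3, inlOp_add_inrOp, smul_neg, neg_smul]
      rw [hTf]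
      exact h2
    · rw [hF, sub_add_cancel_right]
      exact C.graph.neg_mem hb
    · rw [map_neg, h.right_inv, zero_sub, neg_neg]
      exact ha
  -- `S` produces the second component `g` of the data at the cost of `K g` in the first; `T` then
  -- supplies the remainder `(f - K g, 0)`.
  refine ⟨S ∘L WithLp.sndL 2 ℂ X X
    + T ∘L (ω • (WithLp.fstL 2 ℂ X X - K ∘L WithLp.sndL 2 ℂ X X)),
    isBoundedInverse_of_nullSpace (fun z => ?_) ?_⟩
  · have h1 := add_mem_graph (hS z.snd) (hT (z.fst - K z.snd))
    have h2 : WithLp.toLp 2 (K z.snd, z.snd) + inlOp (z.fst - K z.snd) = z :=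
      (WithLp.ofLp_injective 2) (Prod.ext (add_sub_cancel _ _) (add_zero _))
    rw [h2] at h1
    exact h1
  · rw [← Maxwell.isInjective_iff, h.isInjective_iff ε σ hω, Maxwell.isInjective_iff]
    exact hR.nullSpace_eq_bot

/-- The block representation of the inverse of the system. -/
lemma IsAdmissible.inverse_formula (h : IsAdmissible C μ ν) (hω : ω ≠ 0)
    {V : WithLp 2 (X × X) →L[ℂ] WithLp 2 (X × X)}
    (hV : IsBoundedInverse (systemOp C C.adjoint ε μ σ ω) V) :
    ∃ R A B D : X →L[ℂ] X,
      IsBoundedInverse (schurOp C C.adjoint ε ν σ ω) R ∧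
      comp C.adjoint (ofBounded R) = ofBounded A ∧
      (comp (ofBounded R) C).IsClosable ∧
      (comp (ofBounded R) C).closure = ofBounded B ∧
      (comp C.adjoint (comp (ofBounded R) C)).IsClosable ∧
      (comp C.adjoint (comp (ofBounded R) C)).closure = ofBounded D ∧
      IsBoundedInverse (systemOp C C.adjoint ε μ σ ω)
        (blockOp (ω • R) (Complex.I • (B ∘L ν)) (-Complex.I • (ν ∘L A))
          (ω⁻¹ • (-ν + ν ∘L D ∘L ν))) := by
  -- The four operators are obtained by solving the asserted block formula entrywise for its
  -- unknowns. They are bounded by construction; what remains is to identify them with the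
  -- compositions.
  let R : X →L[ℂ] X := ω⁻¹ • (WithLp.fstL 2 ℂ X X ∘L V ∘L inlOp)
  let A : X →L[ℂ] X := Complex.I • (μ ∘L WithLp.sndL 2 ℂ X X ∘L V ∘L inlOp)
  let B : X →L[ℂ] X := -Complex.I • (WithLp.fstL 2 ℂ X X ∘L V ∘L inrOp ∘L μ)
  let D : X →L[ℂ] X := μ ∘L (ω • (WithLp.sndL 2 ℂ X X ∘L V ∘L inrOp ∘L μ) + 1)
  have hR : IsBoundedInverse (schurOp C C.adjoint ε ν σ ω) R := h.isBoundedInverse_schurOp hω hV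
  have hRg := (isBoundedInverse_iff.1 hR)
  have hVg := (isBoundedInverse_iff.1 hV)
  have hA : ∀ f, (R f, A f) ∈ C.adjoint.graph := by
    intro f
    obtain ⟨a, b, ha, -, -, h2⟩ := mem_graph_systemOp.1 (hVg.1 (inlOp f))
    have h3 := smul_mem_graph ω⁻¹ ha
    have h4 : ω⁻¹ • a = A f := by
      change ω⁻¹ • a = Complex.I • μ (V (inlOp f)).snd
      have h5 : (0 : X) = -Complex.I • a - ω • μ (V (inlOp f)).snd := h2
      have h6 : ω • μ (V (inlOp f)).snd = -Complex.I • a := (sub_eq_zero.1 h5.symm).symm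
      rw [← inv_smul_smul₀ hω (μ (V (inlOp f)).snd), h6, smul_smul, smul_smul]
      congr 1
      linear_combination ω⁻¹ * Complex.I_mul_I
    rw [h4] at h3
    exact h3
  have hBD : ∀ x y, (x, y) ∈ C.graph → B x = R y ∧ D x = A y := by
    intro x y hxy
    set E := R y with hE
    obtain ⟨a, b, ha, hb, h1⟩ := mem_graph_schurOp.1 (hRg.1 y)
    obtain rfl : a = A y := LinearPMap.mem_graph_snd_inj _ ha (hA y) rfl
    -- An explicit preimage of `(0, μ x)` when `y = C x`: with `E = R y` one has `C (ν C* E - x) = ω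
    -- (ω ε + i σ) E`, which cancels the first component. Comparison with `V (inrOp (μ x))` gives `B
    -- x` and `D x`.
    have h2 : (WithLp.toLp 2 (Complex.I • E, ω⁻¹ • (ν (A y) - x)), inrOp (μ x)) ∈
        (systemOp C C.adjoint ε μ σ ω).graph := by
      refine mem_graph_systemOp.2 ⟨_, _, smul_mem_graph Complex.I ha,
        smul_mem_graph ω⁻¹ (sub_mem_graph hb hxy), ?_, ?_⟩
      · change (0 : X) = -Complex.I • σ (Complex.I • E) + Complex.I • (ω⁻¹ • (b - y))
          - ω • ε (Complex.I • E)
        have h3 : b - y = ω • (ω • ε E + Complex.I • σ E) := by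
          nth_rewrite 1 [h1]
          abel
        rw [h3, inv_smul_smul₀ hω, map_smul, map_smul]
        module
      · change μ x = -Complex.I • (Complex.I • A y) - ω • μ (ω⁻¹ • (ν (A y) - x))
        rw [map_smul, smul_inv_smul₀ hω, map_sub, h.right_inv, smul_smul, neg_mul,
          Complex.I_mul_I, neg_neg, one_smul, sub_sub_cancel]
    have h3 := hVg.2 _ _ h2
    constructor
    · change -Complex.I • (V (inrOp (μ x))).fst = E
      rw [h3, WithLp.toLp_fst, smul_smul, neg_mul, Complex.I_mul_I, neg_neg, one_smul]
    · change μ (ω • (V (inrOp (μ x))).snd + x) = A y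
      rw [h3, WithLp.toLp_snd, smul_inv_smul₀ hω, sub_add_cancel, h.right_inv]
  have hBc := closure_eq_ofBounded (T := comp (ofBounded R) C) (B := B) ?_ ?_
  have hDc := closure_eq_ofBounded (T := comp C.adjoint (comp (ofBounded R) C)) (B := D) ?_ ?_
  · refine ⟨R, A, B, D, hR, LinearPMap.eq_of_eq_graph ?_, hBc.1, hBc.2, hDc.1, hDc.2, ?_⟩
    · ext ⟨x, y⟩
      rw [mem_graph_comp, mem_graph_ofBounded]
      constructor
      · rintro ⟨v, hv, hvy⟩
        obtain rfl := mem_graph_ofBounded.1 hv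
        exact LinearPMap.mem_graph_snd_inj _ (hA x) hvy rfl
      · rintro rfl
        exact ⟨R x, mem_graph_ofBounded.2 rfl, hA x⟩
    · convert hV using 1
      ext1 z
      have hz : V z = V (inlOp z.fst) + V (inrOp z.snd) := by
        rw [← map_add, inlOp_add_inrOp]
        rfl
      rw [hz]
      refine (WithLp.ofLp_injective 2) (Prod.ext ?_ ?_)
      · change ω • R z.fst + Complex.I • B (ν z.snd)
          = (V (inlOp z.fst)).fst + (V (inrOp z.snd)).fst
        change ω • (ω⁻¹ • (V (inlOp z.fst)).fst)
          + Complex.I • (-Complex.I • (V (inrOp (μ (ν z.snd)))).fst) = _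
        rw [smul_inv_smul₀ hω, h.right_inv, smul_smul, mul_neg, Complex.I_mul_I, neg_neg, one_smul]
      · change -Complex.I • ν (Complex.I • μ (V (inlOp z.fst)).snd)
          + ω⁻¹ • (-ν z.snd + ν (μ (ω • (V (inrOp (μ (ν z.snd)))).snd + ν z.snd)))
          = (V (inlOp z.fst)).snd + (V (inrOp z.snd)).snd
        rw [map_smul, h.left_inv, h.left_inv, h.right_inv, smul_smul, neg_mul, Complex.I_mul_I,
          neg_neg, one_smul, neg_add_cancel_comm_assoc, inv_smul_smul₀ hω]
  · refine h.dense.mono fun x hx => ?_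
    obtain ⟨y, hy⟩ := LinearPMap.mem_domain_iff.1 hx
    exact LinearPMap.mem_domain_iff.2 ⟨A y, mem_graph_comp.2
      ⟨R y, mem_graph_comp.2 ⟨y, hy, mem_graph_ofBounded.2 rfl⟩, hA y⟩⟩
  · intro x w hx
    obtain ⟨v, hv, hvw⟩ := mem_graph_comp.1 hx
    obtain ⟨y, hy, hyv⟩ := mem_graph_comp.1 hv
    obtain rfl := mem_graph_ofBounded.1 hyv
    rw [(hBD x y hy).2]
    exact LinearPMap.mem_graph_snd_inj _ (hA y) hvw rfl
  · refine h.dense.mono fun x hx => ?_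
    obtain ⟨y, hy⟩ := LinearPMap.mem_domain_iff.1 hx
    exact LinearPMap.mem_domain_iff.2 ⟨R y, mem_graph_comp.2 ⟨y, hy, mem_graph_ofBounded.2 rfl⟩⟩
  · intro x w hx
    obtain ⟨y, hy, hyw⟩ := mem_graph_comp.1 hx
    rw [(hBD x y hy).1]
    exact mem_graph_ofBounded.1 hyw

end Resolvent

end Equivalence

/-! ### Conjugation symmetry and the residual spectrum -/

section ResidualSpectrum

variable {X : Type*} [NormedAddCommGroup X] [InnerProductSpace ℂ X] [CompleteSpace X]
variable {C : X →ₗ.[ℂ] X} {ε μ ν σ : X →L[ℂ] X} {ω : ℂ}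

/-- `J` is a complex conjugation that commutes with `C`. -/
structure IsConjugation (J : X →ₛₗ[starRingEnd ℂ] X) (C : X →ₗ.[ℂ] X) : Prop where
  involutive : ∀ x, J (J x) = x
  inner_map : ∀ x y, inner ℂ (J x) (J y) = starRingEnd ℂ (inner ℂ x y)
  map_graph : ∀ x y, (x, y) ∈ C.graph → (J x, J y) ∈ C.graph

/-- `J` preserves the inner product up to conjugation and maps the graph of `C` to itself, so the
identity defining the adjoint may be tested on conjugated pairs. -/
lemma IsConjugation.map_graph_adjoint {J : X →ₛₗ[starRingEnd ℂ] X} (hJ : IsConjugation J C)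
    (hC : Dense (C.domain : Set X)) {y w : X} (h : (y, w) ∈ C.adjoint.graph) :
    (J y, J w) ∈ C.adjoint.graph := by
  refine (mem_graph_adjoint hC).2 fun x v hx => ?_
  have h1 := (mem_graph_adjoint hC).1 h _ _ (hJ.map_graph _ _ hx)
  rw [← hJ.involutive v, ← hJ.involutive x, hJ.inner_map, hJ.inner_map, h1]

/-- Elements orthogonal to the range of `C ν C* - ω (ω ε + i σ)` are the complex conjugates of
elements of its kernel. -/
lemma IsAdmissible.map_mem_nullSpace (h : IsAdmissible C μ ν)
    (hν : ∀ x y, inner ℂ (ν x) y = inner ℂ x (ν y)) (hε : ∀ x y, inner ℂ (ε x) y = inner ℂ x (ε y))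
    (hσ : ∀ x y, inner ℂ (σ x) y = inner ℂ x (σ y)) {J : X →ₛₗ[starRingEnd ℂ] X}
    (hJ : IsConjugation J C) (hJν : ∀ x, J (ν x) = ν (J x)) (hJε : ∀ x, J (ε x) = ε (J x))
    (hJσ : ∀ x, J (σ x) = σ (J x)) {f : X}
    (hf : ∀ E w, (E, w) ∈ (schurOp C C.adjoint ε ν σ ω).graph → inner ℂ f w = 0) :
    J f ∈ nullSpace (schurOp C C.adjoint ε ν σ ω) := by
  obtain ⟨m, hm, hμ⟩ := h.coercive
  obtain ⟨P, Q, hPQ, -⟩ := exists_auxiliary_solution h.dense h.closed hm hμ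
  -- With second datum zero the auxiliary problem reads `(1 + C ν C*) P (g, 0) = g`.
  have hsol : ∀ g, (P (g, 0), -μ (Q (g, 0))) ∈ C.adjoint.graph ∧
      (ν (-μ (Q (g, 0))), g - P (g, 0)) ∈ C.graph := by
    intro g
    obtain ⟨h1, h2⟩ := hPQ g 0
    rw [zero_sub] at h2
    refine ⟨h2, ?_⟩
    rw [map_neg, h.left_inv, ← neg_sub]
    exact C.graph.neg_mem h1
  set ω' := starRingEnd ℂ ω with hω'
  -- `k` is the Hilbert-space adjoint of `ω (ω ε + i σ)` applied to `f`. The goal is `C ν C* f = k`,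
  -- although `f` is not yet known to lie in the domain; it follows from `f = u`, where `u = (1 + C
  -- ν C*)⁻¹ (f + k)`.
  set k : X := ω' • (ω' • ε f - Complex.I • σ f) with hk
  set u := P (f + k, 0) with hu
  obtain ⟨hu1, hu2⟩ := hsol (f + k)
  have hfu : f = u := by
    -- The test vector `E = (1 + C ν C*)⁻¹ (f - u)` lies in the domain of the Schur complement.
    -- Orthogonality gives `⟨f, f - u - E⟩ = ⟨k, E⟩`, and symmetry of `C ν C*` gives `⟨u, f - u - E⟩
    -- = ⟨f + k - u, E⟩`.
    set E := P (f - u, 0) with hE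
    obtain ⟨hE1, hE2⟩ := hsol (f - u)
    rw [← hE] at hE1 hE2
    rw [← hu] at hu1 hu2
    have e1 := hf _ _ (mem_graph_schurOp.2 ⟨_, _, hE1, hE2, rfl⟩)
    have e2 : inner ℂ f (ω • (ω • ε E + Complex.I • σ E)) = inner ℂ k E := by
      simp only [hk, hω', inner_smul_left, inner_smul_right, inner_sub_left, inner_add_right,
        hε, hσ, Complex.conj_conj, Complex.conj_I]
      ring
    rw [inner_sub_right, e2] at e1
    have e3 := (mem_graph_adjoint h.dense).1 hu1 _ _ hE2
    have e4 := (mem_graph_adjoint h.dense).1 hE1 _ _ hu2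
    rw [← hν] at e3
    have e5 := congrArg (starRingEnd ℂ) e4
    rw [inner_conj_symm, inner_conj_symm] at e5
    rw [← e5] at e3
    -- Split the right-hand slot as `(f - u - E) + E`; the two identities make the parts cancel.
    have e6 : inner ℂ (f - u) (f - u) = 0 := by
      rw [← sub_add_cancel (f - u) E, inner_add_right]
      conv_lhs => rw [sub_add_cancel]
      rw [inner_sub_left, e3, sub_eq_zero.1 e1]
      simp only [inner_sub_left, inner_add_left]
      ring
    exact sub_eq_zero.1 (inner_self_eq_zero.1 e6)
  rw [← hu, ← hfu, add_sub_cancel_left] at hu2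
  rw [← hu, ← hfu] at hu1
  have h3 := hJ.map_graph_adjoint h.dense hu1
  have h4 := hJ.map_graph _ _ hu2
  rw [hJν] at h4
  refine mem_nullSpace.2 (mem_graph_schurOp.2 ⟨_, _, h3, h4, ?_⟩)
  rw [eq_comm, sub_eq_zero, hk]
  simp only [map_smulₛₗ, map_sub, hJε, hJσ, hω', Complex.conj_conj, Complex.conj_I]
  module

lemma IsAdmissible.hasDenseRange_of_isInjective (h : IsAdmissible C μ ν)
    (hν : ∀ x y, inner ℂ (ν x) y = inner ℂ x (ν y)) (hε : ∀ x y, inner ℂ (ε x) y = inner ℂ x (ε y))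
    (hσ : ∀ x y, inner ℂ (σ x) y = inner ℂ x (σ y)) {J : X →ₛₗ[starRingEnd ℂ] X}
    (hJ : IsConjugation J C) (hJν : ∀ x, J (ν x) = ν (J x)) (hJε : ∀ x, J (ε x) = ε (J x))
    (hJσ : ∀ x, J (σ x) = σ (J x)) (hi : IsInjective (schurOp C C.adjoint ε ν σ ω)) :
    HasDenseRange (schurOp C C.adjoint ε ν σ ω) := by
  rw [HasDenseRange, Submodule.dense_iff_topologicalClosure_eq_top,
    Submodule.topologicalClosure_eq_top_iff, Submodule.eq_bot_iff]
  intro f hf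
  have h1 := h.map_mem_nullSpace (ω := ω) hν hε hσ hJ hJν hJε hJσ (f := f) fun E w hw =>
    (Submodule.mem_orthogonal' _ _).1 hf w (mem_range_iff_graph.2 ⟨E, hw⟩)
  rw [Maxwell.isInjective_iff.1 hi, Submodule.mem_bot] at h1
  rw [← hJ.involutive f, h1, map_zero]

end ResidualSpectrum

/-! ### Infinite nullity and defect at `ω = 0` -/

section AtZero

variable {X : Type*} [NormedAddCommGroup X] [InnerProductSpace ℂ X] [CompleteSpace X]
variable {C : X →ₗ.[ℂ] X}

/-- At `ω = 0` only `C ν C*` remains: its kernel contains `ker C*`, and its range lies in the range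
of `C`, which is orthogonal to `ker C*`. -/
lemma schurOp_zero (hC : Dense (C.domain : Set X))
    (hN : ¬ FiniteDimensional ℂ (nullSpace C.adjoint)) (ε ν σ : X →L[ℂ] X) :
    ¬ FiniteNullity (schurOp C C.adjoint ε ν σ 0) ∧ ¬ FiniteDefect (schurOp C C.adjoint ε ν σ 0) := by
  constructor
  · rw [finiteNullity_iff]
    intro hfin
    refine hN (Submodule.finiteDimensional_of_le (S₂ := nullSpace (schurOp C C.adjoint ε ν σ 0))
      fun n hn => mem_nullSpace.2 (mem_graph_schurOp.2 ⟨0, 0, mem_nullSpace.1 hn, ?_, ?_⟩))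
    · rw [map_zero]
      exact C.graph.zero_mem
    · rw [zero_smul, sub_zero]
  · refine not_finiteDefect_of_orthogonal hN fun x y hxy n hn => ?_
    obtain ⟨a, b, -, hb, rfl⟩ := mem_graph_schurOp.1 hxy
    rw [zero_smul, sub_zero, (mem_graph_adjoint hC).1 (mem_nullSpace.1 hn) _ _ hb, inner_zero_left]

/-- The subspace `0 ⊕ ker C*` serves twice. It lies in the kernel because `C* ≤ C`, and it is
orthogonal to the range because second components there are multiples of vectors `C* E`, orthogonal
to `ker C`. -/
lemma systemOp_zero (hC : Dense (C.domain : Set X)) (hle : C.adjoint ≤ C)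
    (hN : ¬ FiniteDimensional ℂ (nullSpace C.adjoint)) (ε μ σ : X →L[ℂ] X) :
    ¬ FiniteNullity (systemOp C C.adjoint ε μ σ 0) ∧
      ¬ FiniteDefect (systemOp C C.adjoint ε μ σ 0) := by
  have hinj : Function.Injective (inrOp (X := X)).toLinearMap := fun x y hxy =>
    congrArg WithLp.snd hxy
  have hN' : ¬ FiniteDimensional ℂ ((nullSpace C.adjoint).map (inrOp (X := X)).toLinearMap) :=
    fun hfin => hN ((Module.Finite.equiv_iff (Submodule.equivMapOfInjective _ hinj _)).2 hfin)
  have hNC : ∀ n ∈ nullSpace C.adjoint, (n, (0 : X)) ∈ C.graph := fun n hn =>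
    LinearPMap.le_graph_of_le hle (mem_nullSpace.1 hn)
  constructor
  · rw [finiteNullity_iff]
    intro hfin
    refine hN' (Submodule.finiteDimensional_of_le
      (S₂ := nullSpace (systemOp C C.adjoint ε μ σ 0)) ?_)
    rintro _ ⟨n, hn, rfl⟩
    refine mem_nullSpace.2 (mem_graph_systemOp.2 ⟨0, 0, C.adjoint.graph.zero_mem, hNC n hn, ?_, ?_⟩)
    · change (0 : X) = -Complex.I • σ 0 + Complex.I • 0 - (0 : ℂ) • ε 0
      simp
    · change (0 : X) = -Complex.I • 0 - (0 : ℂ) • μ n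
      simp
  · refine not_finiteDefect_of_orthogonal hN' ?_
    rintro z w hzw _ ⟨n, hn, rfl⟩
    obtain ⟨a, b, ha, -, -, h2⟩ := mem_graph_systemOp.1 hzw
    have h3 := (mem_graph_adjoint hC).1 ha _ _ (hNC n hn)
    rw [inner_zero_right] at h3
    have h4 : inner ℂ n a = 0 := by rw [← inner_conj_symm, ← h3, map_zero]
    rw [WithLp.prod_inner_apply]
    change inner ℂ (0 : X) w.fst + inner ℂ n w.snd = 0
    rw [h2, zero_smul, sub_zero, inner_smul_right, h4, inner_zero_left, mul_zero, add_zero]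

end AtZero

/-! ### Closedness of `curl` -/

variable {Ω : TopologicalSpace.Opens R3}

lemma mem_graph_curl {u w : L2 Ω} : (u, w) ∈ (curl Ω).graph ↔ IsWeakCurl u w := by
  rw [curl_graph]
  rfl

lemma curl_isClosed (Ω : TopologicalSpace.Opens R3) : (curl Ω).IsClosed := by
  have h : ((curl Ω).graph : Set (L2 Ω × L2 Ω)) = ⋂ (φ : R3 → C3) (h : IsTestField Ω φ),
      {p | inner ℂ (h.memLp_curl.toLp _) p.1 = inner ℂ (h.memLp.toLp _) p.2} := by
    ext ⟨u, w⟩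
    rw [SetLike.mem_coe, mem_graph_curl, isWeakCurl_iff]
    simp
  rw [LinearPMap.IsClosed, h]
  refine isClosed_iInter fun φ => isClosed_iInter fun h => isClosed_eq ?_ ?_
  · exact continuous_const.inner continuous_fst
  · exact continuous_const.inner continuous_snd

/-! ### Multiplication by matrix coefficients -/

section Multiplication

lemma MatrixField.coeFn_op (M : MatrixField Ω) (f : L2 Ω) :
    M.op f =ᵐ[volume.restrict (Ω : Set R3)] fun x => matVec (M.toFun x) (f x) :=
  (M.memLp f).coeFn_toLp

lemma inner_matVec_left {A : Matrix (Fin 3) (Fin 3) ℝ} (hA : A.IsSymm) (v w : C3) :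
    inner ℂ (matVec A v) w = inner ℂ v (matVec A w) := by
  have h01 := hA.apply 0 1
  have h02 := hA.apply 0 2
  have h12 := hA.apply 1 2
  simp only [matVec, PiLp.inner_apply, Fin.sum_univ_three, RCLike.inner_apply, map_add, map_mul,
    Complex.conj_ofReal, h01, h02, h12]
  ring

lemma MatrixField.HasBounds.inner_op_left {M : MatrixField Ω} {a b : ℝ} (h : M.HasBounds a b)
    (f g : L2 Ω) : inner ℂ (M.op f) g = inner ℂ f (M.op g) := by
  rw [L2.inner_def, L2.inner_def]
  refine integral_congr_ae ?_
  filter_upwards [h, M.coeFn_op f, M.coeFn_op g] with x hx hf hg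
  rw [hf, hg, inner_matVec_left hx.1]

/-- As `A` is real, the real part of the form splits into the real quadratic forms of `Re v` and `Im
v`. -/
lemma re_inner_matVec_ge {A : Matrix (Fin 3) (Fin 3) ℝ} {a : ℝ}
    (h : ∀ η : Fin 3 → ℝ, η ⬝ᵥ η = 1 → a ≤ η ⬝ᵥ A.mulVec η) (v : C3) :
    a * ‖v‖ ^ 2 ≤ (inner ℂ (matVec A v) v).re := by
  have h1 := coercive_of_unit h fun i => (v i).re
  have h2 := coercive_of_unit h fun i => (v i).im
  have h3 : ‖v‖ ^ 2 = (fun i => (v i).re) ⬝ᵥ (fun i => (v i).re)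
      + (fun i => (v i).im) ⬝ᵥ (fun i => (v i).im) := by
    simp only [EuclideanSpace.norm_sq_eq, dotProduct, ← Finset.sum_add_distrib,
      ← Complex.normSq_eq_norm_sq, Complex.normSq_apply]
  have h4 : (inner ℂ (matVec A v) v).re
      = (fun i => (v i).re) ⬝ᵥ A.mulVec (fun i => (v i).re)
        + (fun i => (v i).im) ⬝ᵥ A.mulVec (fun i => (v i).im) := by
    simp [matVec, PiLp.inner_apply, Fin.sum_univ_three, dotProduct, Matrix.mulVec]
    ring
  rw [h3, h4, mul_add]
  exact add_le_add h1 h2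

lemma MatrixField.HasBounds.re_inner_op_ge {M : MatrixField Ω} {a b : ℝ} (h : M.HasBounds a b)
    (f : L2 Ω) : a * ‖f‖ ^ 2 ≤ (inner ℂ (M.op f) f).re := by
  have hre : ∀ g k : L2 Ω, (inner ℂ g k).re
      = ∫ x in (Ω : Set R3), (inner ℂ (g x) (k x)).re := fun g k => by
    rw [L2.inner_def]
    exact (integral_re (L2.integrable_inner (𝕜 := ℂ) g k)).symm
  have h1 : ‖f‖ ^ 2 = (inner ℂ f f).re := (inner_self_eq_norm_sq (𝕜 := ℂ) f).symm
  rw [h1, hre, hre, ← integral_const_mul]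
  have hint : ∀ g k : L2 Ω, Integrable (fun x => (inner ℂ (g x) (k x)).re)
      (volume.restrict (Ω : Set R3)) := fun g k => (L2.integrable_inner (𝕜 := ℂ) g k).re
  refine integral_mono_ae ((hint f f).const_mul a) (hint (M.op f) f) ?_
  filter_upwards [h, M.coeFn_op f] with x hx hf
  have h2 : (inner ℂ (f x) (f x)).re = ‖f x‖ ^ 2 :=
    inner_self_eq_norm_sq (𝕜 := ℂ) (f x : C3)
  change a * (inner ℂ (f x) (f x)).re ≤ (inner ℂ (M.op f x) (f x)).re
  rw [hf, h2]
  exact re_inner_matVec_ge (fun η hη => (hx.2 η hη).1) _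

lemma isUnit_det_of_unit {A : Matrix (Fin 3) (Fin 3) ℝ} {a : ℝ} (ha : 0 < a)
    (h : ∀ η : Fin 3 → ℝ, η ⬝ᵥ η = 1 → a ≤ η ⬝ᵥ A.mulVec η) : IsUnit A.det := by
  rw [isUnit_iff_ne_zero]
  intro h0
  obtain ⟨v, hv, hAv⟩ := Matrix.exists_mulVec_eq_zero_iff.2 h0
  have h1 := coercive_of_unit h v
  rw [hAv, dotProduct_zero] at h1
  have h2 : 0 < v ⬝ᵥ v := lt_of_le_of_ne (Finset.sum_nonneg fun i _ => mul_self_nonneg (v i))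
    fun h3 => hv (dotProduct_self_eq_zero.1 h3.symm)
  exact absurd h1 (not_le.2 (mul_pos ha h2))

lemma matVec_matVec (A B : Matrix (Fin 3) (Fin 3) ℝ) (v : C3) :
    matVec A (matVec B v) = matVec (A * B) v := by
  ext i
  simp [matVec, Matrix.mul_apply, Fin.sum_univ_three]
  ring

lemma matVec_one (v : C3) : matVec 1 v = v := by
  ext i
  fin_cases i <;> simp [matVec, Matrix.one_apply, Fin.sum_univ_three]

lemma MatrixField.op_inv_op (M : MatrixField Ω) {a b : ℝ} (ha : 0 < a) (h : M.HasBounds a b)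
    (f : L2 Ω) : (M.inv ha h).op (M.op f) = f := by
  refine Lp.ext ?_
  filter_upwards [h, M.coeFn_op f, (M.inv ha h).coeFn_op (M.op f)] with x hx h1 h2
  rw [h2, h1, matVec_matVec]
  change matVec ((M.toFun x)⁻¹ * M.toFun x) _ = _
  rw [Matrix.nonsing_inv_mul _ (isUnit_det_of_unit ha fun η hη => (hx.2 η hη).1), matVec_one]

lemma MatrixField.op_op_inv (M : MatrixField Ω) {a b : ℝ} (ha : 0 < a) (h : M.HasBounds a b)
    (f : L2 Ω) : M.op ((M.inv ha h).op f) = f := by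
  refine Lp.ext ?_
  filter_upwards [h, M.coeFn_op ((M.inv ha h).op f), (M.inv ha h).coeFn_op f] with x hx h1 h2
  rw [h1, h2, matVec_matVec]
  change matVec (M.toFun x * (M.toFun x)⁻¹) _ = _
  rw [Matrix.mul_nonsing_inv _ (isUnit_det_of_unit ha fun η hη => (hx.2 η hη).1), matVec_one]

end Multiplication

/-! ### Complex conjugation of vector fields -/

section Conjugation

/-- Componentwise complex conjugation in `ℂ³`. -/
def conjC3 : C3 →SL[starRingEnd ℂ] C3 :=
  LinearMap.mkContinuous
    { toFun := fun v => WithLp.toLp 2 fun i => starRingEnd ℂ (v i)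
      map_add' := fun v w => by ext i; simp
      map_smul' := fun c v => by ext i; simp } 1 fun v => by
    simp [EuclideanSpace.norm_eq]

lemma conjC3_apply (v : C3) (i : Fin 3) : conjC3 v i = starRingEnd ℂ (v i) := rfl

lemma conjC3_conjC3 (v : C3) : conjC3 (conjC3 v) = v := by
  ext i
  simp [conjC3_apply]

lemma inner_conjC3 (v w : C3) : inner ℂ (conjC3 v) (conjC3 w) = starRingEnd ℂ (inner ℂ v w) := by
  simp [PiLp.inner_apply, conjC3_apply]

lemma conjC3_matVec (A : Matrix (Fin 3) (Fin 3) ℝ) (v : C3) :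
    conjC3 (matVec A v) = matVec A (conjC3 v) := by
  ext i
  simp [matVec, conjC3_apply]

/-- Complex conjugation in `L²(Ω)³`. -/
def conjL2 (Ω : TopologicalSpace.Opens R3) : L2 Ω →ₛₗ[starRingEnd ℂ] L2 Ω :=
  conjC3.compLpₗ 2 (volume.restrict (Ω : Set R3))

lemma coeFn_conjL2 (f : L2 Ω) :
    conjL2 Ω f =ᵐ[volume.restrict (Ω : Set R3)] fun x => conjC3 (f x) :=
  conjC3.coeFn_compLp' f

lemma conjL2_conjL2 (f : L2 Ω) : conjL2 Ω (conjL2 Ω f) = f := by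
  refine Lp.ext ?_
  filter_upwards [coeFn_conjL2 f, coeFn_conjL2 (conjL2 Ω f)] with x h1 h2
  rw [h2, h1, conjC3_conjC3]

lemma inner_conjL2 (f g : L2 Ω) :
    inner ℂ (conjL2 Ω f) (conjL2 Ω g) = starRingEnd ℂ (inner ℂ f g) := by
  rw [L2.inner_def, L2.inner_def, ← integral_conj]
  refine integral_congr_ae ?_
  filter_upwards [coeFn_conjL2 f, coeFn_conjL2 g] with x h1 h2
  rw [h1, h2, inner_conjC3]

lemma conjL2_op (M : MatrixField Ω) (f : L2 Ω) : conjL2 Ω (M.op f) = M.op (conjL2 Ω f) := by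
  refine Lp.ext ?_
  filter_upwards [coeFn_conjL2 f, coeFn_conjL2 (M.op f), M.coeFn_op f,
    M.coeFn_op (conjL2 Ω f)] with x h1 h2 h3 h4
  rw [h2, h3, h4, h1, conjC3_matVec]

lemma IsTestField.conj {φ : R3 → C3} (h : IsTestField Ω φ) :
    IsTestField Ω fun x => conjC3 (φ x) := by
  have hs : tsupport (fun x => conjC3 (φ x)) ⊆ tsupport φ :=
    closure_mono fun x hx h0 => hx (by simp only [h0, map_zero])
  refine ⟨?_, h.compact.of_isClosed_subset (isClosed_tsupport _) hs, hs.trans h.supp⟩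
  refine contDiff_piLp 2 |>.2 fun i => ?_
  exact Complex.conjCLE.toContinuousLinearMap.contDiff.comp (h.contDiff_apply i)

lemma IsTestField.classicalCurl_conj {φ : R3 → C3} (h : IsTestField Ω φ) (x : R3) :
    classicalCurl (fun x => conjC3 (φ x)) x = conjC3 (classicalCurl φ x) := by
  have key : ∀ j i, partialDeriv (fun x => conjC3 (φ x)) j i x
      = starRingEnd ℂ (partialDeriv φ j i x) := fun j i => by
    rw [h.conj_partialDeriv_eq, h.conj.partialDeriv_eq]
    rfl
  ext i
  rw [conjC3_apply]
  fin_cases i <;> simp [classicalCurl, key]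

/-- Conjugation preserves test fields and commutes with their curl, so it can be moved from the
fields to the test field. -/
lemma IsWeakCurl.conj {u w : L2 Ω} (h : IsWeakCurl u w) :
    IsWeakCurl (conjL2 Ω u) (conjL2 Ω w) := by
  intro φ hφ
  have h1 := congrArg (starRingEnd ℂ) (h _ hφ.conj)
  rw [← integral_conj, ← integral_conj] at h1
  convert h1 using 1
  · refine integral_congr_ae ?_
    filter_upwards [coeFn_conjL2 u] with x hx
    rw [hx, hφ.classicalCurl_conj, ← inner_conjC3, conjC3_conjC3]
  · refine integral_congr_ae ?_
    filter_upwards [coeFn_conjL2 w] with x hx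
    rw [hx, ← inner_conjC3, conjC3_conjC3]

lemma isConjugation_conjL2 (Ω : TopologicalSpace.Opens R3) : IsConjugation (conjL2 Ω) (curl Ω) where
  involutive := conjL2_conjL2
  inner_map := inner_conjL2
  map_graph _ _ h := mem_graph_curl.2 (mem_graph_curl.1 h).conj

end Conjugation

/-! ### Gradients in the kernel of `curl₀` -/

section GradientFields

/-- A curl-free test field lies in the kernel of `curl₀`. -/
lemma IsTestField.mem_nullSpace_curl₀ {φ : R3 → C3} (h : IsTestField Ω φ)
    (h0 : ∀ x, classicalCurl φ x = 0) : h.memLp.toLp φ ∈ nullSpace (curl Ω).adjoint := by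
  refine mem_nullSpace.2 ((mem_graph_adjoint (dense_curl_domain Ω)).2 fun u w huw => ?_)
  have h1 : IsWeakCurl u w := by
    rw [curl_graph] at huw
    exact huw
  have h2 := h1 φ h
  rw [← integral_inner_eq h.memLp, ← h2, inner_zero_left]
  simp [h0]

/-- The gradient of a real function, as a complex vector field. -/
def gradField (g : R3 → ℝ) (x : R3) : C3 :=
  WithLp.toLp 2 fun i => (fderiv ℝ g x (EuclideanSpace.single i 1) : ℂ)

lemma tsupport_gradField_subset (g : R3 → ℝ) : tsupport (gradField g) ⊆ tsupport g := by
  refine closure_minimal (fun x hx => ?_) (isClosed_tsupport g)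
  by_contra hne
  have h0 : fderiv ℝ g x = 0 := by
    by_contra h1
    exact hne (support_fderiv_subset ℝ (by simpa [Function.mem_support] using h1))
  refine hx ?_
  ext i
  simp [gradField, h0]

lemma isTestField_gradField {g : R3 → ℝ} (hg : ContDiff ℝ (⊤ : ℕ∞) g) (hc : HasCompactSupport g)
    (hs : tsupport g ⊆ Ω) : IsTestField Ω (gradField g) := by
  refine ⟨?_, hc.of_isClosed_subset (isClosed_tsupport _) (tsupport_gradField_subset g),
    (tsupport_gradField_subset g).trans hs⟩
  refine contDiff_piLp 2 |>.2 fun i => ?_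
  have h1 : ContDiff ℝ (⊤ : ℕ∞) fun x => fderiv ℝ g x (EuclideanSpace.single i 1) :=
    (hg.fderiv_right (m := (⊤ : ℕ∞)) (by simp)).clm_apply contDiff_const
  exact Complex.ofRealCLM.contDiff.comp h1

lemma classicalCurl_gradField {g : R3 → ℝ} (hg : ContDiff ℝ (⊤ : ℕ∞) g) (hc : HasCompactSupport g)
    (hs : tsupport g ⊆ Ω) (x : R3) : classicalCurl (gradField g) x = 0 := by
  have hsymm : IsSymmSndFDerivAt ℝ g x := hg.contDiffAt.isSymmSndFDerivAt
    (by rw [minSmoothness_of_isRCLikeNormedField]; exact WithTop.coe_le_coe.2 (le_top : (2 : ℕ∞) ≤ ⊤))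
  have hd : DifferentiableAt ℝ (fderiv ℝ g) x :=
    (hg.fderiv_right (m := (⊤ : ℕ∞)) (by simp)).differentiable (by simp) x
  have key : ∀ j i, partialDeriv (gradField g) j i x = (fderiv ℝ (fderiv ℝ g) x
      (EuclideanSpace.single j 1) (EuclideanSpace.single i 1) : ℂ) := by
    intro j i
    rw [(isTestField_gradField hg hc hs).partialDeriv_eq]
    have h1 : HasFDerivAt (fun y => fderiv ℝ g y (EuclideanSpace.single i 1)) _ x :=
      hd.hasFDerivAt.clm_apply (hasFDerivAt_const (EuclideanSpace.single i (1 : ℝ)) x)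
    have h2 : fderiv ℝ (fun y => gradField g y i) x = _ :=
      (Complex.ofRealCLM.hasFDerivAt.comp x h1).fderiv
    rw [h2]
    simp
  have hs2 : ∀ j i, partialDeriv (gradField g) j i x = partialDeriv (gradField g) i j x := by
    intro j i
    rw [key, key, hsymm.eq]
  ext i
  fin_cases i
  · simp [classicalCurl, hs2 1 2]
  · simp [classicalCurl, hs2 2 0]
  · simp [classicalCurl, hs2 0 1]

/-- A gradient vanishing almost everywhere vanishes identically by continuity. Then `g` is a
non-zero constant, which cannot have compact support in the non-compact space `R3`. -/
lemma gradField_toLp_ne_zero {g : R3 → ℝ} (hg : ContDiff ℝ (⊤ : ℕ∞) g) (hc : HasCompactSupport g)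
    (hs : tsupport g ⊆ Ω) {x₀ : R3} (hx₀ : g x₀ ≠ 0) :
    (isTestField_gradField hg hc hs).memLp.toLp (gradField g) ≠ 0 := by
  intro h0
  have hT := isTestField_gradField hg hc hs
  have h1 : gradField g =ᵐ[volume] fun _ => 0 := by
    have h2 : ∀ᵐ x ∂(volume.restrict (Ω : Set R3)), gradField g x = 0 := by
      have h3 := hT.memLp.coeFn_toLp
      rw [h0] at h3
      filter_upwards [h3, Lp.coeFn_zero C3 2 (volume.restrict (Ω : Set R3))] with x hx hx'
      rw [← hx, hx']
      rfl
    rw [ae_restrict_iff' Ω.isOpen.measurableSet] at h2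
    filter_upwards [h2] with x hx
    by_cases hxΩ : x ∈ (Ω : Set R3)
    · exact hx hxΩ
    · exact image_eq_zero_of_notMem_tsupport fun hx' => hxΩ (hT.supp hx')
  have h2 := (hT.smooth.continuous.ae_eq_iff_eq volume continuous_const).1 h1
  have h3 : ∀ x, fderiv ℝ g x = 0 := by
    intro x
    have h4 : ∀ i, fderiv ℝ g x (EuclideanSpace.single i 1) = 0 := fun i => by
      have h5 := congrArg (fun v : C3 => v i) (congrFun h2 x)
      simpa [gradField] using h5
    refine ContinuousLinearMap.coe_injective
      ((EuclideanSpace.basisFun (Fin 3) ℝ).toBasis.ext fun i => ?_)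
    simpa using h4 i
  have h4 : ∀ x, x ∈ tsupport g := fun x => subset_tsupport g (by
    rw [Function.mem_support, is_const_of_fderiv_eq_zero (hg.differentiable (by simp)) h3 x x₀]
    exact hx₀)
  have h5 : IsCompact (Set.univ : Set R3) := by
    rw [← Set.eq_univ_of_forall h4]
    exact hc
  exact noncompact_univ R3 h5

lemma inner_gradField_eq_zero {g k : R3 → ℝ} (hg : IsTestField Ω (gradField g))
    (hk : IsTestField Ω (gradField k)) (h : Disjoint (tsupport g) (tsupport k)) :
    inner ℂ (hg.memLp.toLp (gradField g)) (hk.memLp.toLp (gradField k)) = 0 := by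
  rw [← integral_inner_eq hg.memLp]
  refine integral_eq_zero_of_ae ?_
  filter_upwards [hk.memLp.coeFn_toLp] with x hx
  rw [hx]
  by_cases hx' : x ∈ tsupport g
  · rw [image_eq_zero_of_notMem_tsupport (f := gradField k) fun h' =>
      Set.disjoint_left.1 h hx' (tsupport_gradField_subset k h'), inner_zero_right]
    rfl
  · rw [image_eq_zero_of_notMem_tsupport (f := gradField g) fun h' =>
      hx' (tsupport_gradField_subset g h'), inner_zero_left]
    rfl

/-- A non-empty open set contains infinitely many disjoint supports of smooth functions. -/
lemma exists_seq_smooth_disjoint (hΩ : (Ω : Set R3).Nonempty) :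
    ∃ g : ℕ → R3 → ℝ, (∀ n, ContDiff ℝ (⊤ : ℕ∞) (g n)) ∧ (∀ n, HasCompactSupport (g n)) ∧
      (∀ n, tsupport (g n) ⊆ Ω) ∧ (∀ n, ∃ x, g n x ≠ 0) ∧
      Pairwise fun m n => Disjoint (tsupport (g m)) (tsupport (g n)) := by
  obtain ⟨x₀, hx₀⟩ := hΩ
  have hinf : (Ω : Set R3).Infinite := infinite_of_mem_nhds x₀ (Ω.isOpen.mem_nhds hx₀)
  have : Infinite Ω := hinf.to_subtype
  -- The infinite Hausdorff space `Ω` contains a sequence of disjoint non-empty open sets; a bump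
  -- function is placed in each.
  obtain ⟨U, hUi, hUo, hUd⟩ := exists_seq_infinite_isOpen_pairwise_disjoint Ω
  choose p hp using fun n => (hUi n).nonempty
  have hV : ∀ n, Subtype.val '' U n ∈ nhds (p n : R3) := fun n =>
    (Ω.isOpen.isOpenMap_subtype_val _ (hUo n)).mem_nhds ⟨p n, hp n, rfl⟩
  choose g hgs hgc hg _ hg1 using fun n =>
    exists_contDiff_tsupport_subset (n := ⊤) (hV n)
  refine ⟨g, hg, hgc, fun n => (hgs n).trans ?_, fun n => ⟨p n, by simp [hg1 n]⟩,
    fun m n hmn => ?_⟩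
  · rintro _ ⟨y, -, rfl⟩
    exact y.2
  · exact ((Set.disjoint_image_iff Subtype.val_injective).2 (hUd hmn)).mono (hgs m) (hgs n)

/-- The kernel of `curl₀` is infinite-dimensional, since it contains all gradients of test
functions. -/
theorem not_finiteDimensional_nullSpace_curl₀ (hΩ : (Ω : Set R3).Nonempty) :
    ¬ FiniteDimensional ℂ (nullSpace (curl Ω).adjoint) := by
  intro hfin
  obtain ⟨g, hg, hc, hs, hne, hd⟩ := exists_seq_smooth_disjoint hΩ
  have hT := fun n => isTestField_gradField (hg n) (hc n) (hs n)
  let v : ℕ → nullSpace (curl Ω).adjoint := fun n => ⟨(hT n).memLp.toLp _,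
    (hT n).mem_nullSpace_curl₀ (classicalCurl_gradField (hg n) (hc n) (hs n))⟩
  -- Disjoint supports make the gradients orthogonal, so a single potential per set suffices.
  have hv : LinearIndependent ℂ v := by
    refine linearIndependent_of_ne_zero_of_inner_eq_zero (fun n h0 => ?_) fun m n hmn =>
      inner_gradField_eq_zero (hT m) (hT n) (hd hmn)
    obtain ⟨x, hx⟩ := hne n
    exact gradField_toLp_ne_zero (hg n) (hc n) (hs n) hx (congrArg Subtype.val h0)
  exact Infinite.not_finite (hv.finite : Finite ℕ)

end GradientFields

/-! ### The Maxwell pencils as instances -/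

section MaxwellSystem

variable (c : Coefficients Ω)

lemma Coefficients.isAdmissible : IsAdmissible (curl Ω) c.mu.op c.muInv.op where
  dense := dense_curl_domain Ω
  closed := curl_isClosed Ω
  coercive := ⟨c.muMin, c.muMin_pos, c.mu_bounds.re_inner_op_ge⟩
  left_inv := c.mu.op_inv_op c.muMin_pos c.mu_bounds
  right_inv := c.mu.op_op_inv c.muMin_pos c.mu_bounds

lemma Coefficients.inner_muInv_left (f g : L2 Ω) :
    inner ℂ (c.muInv.op f) g = inner ℂ f (c.muInv.op g) := by
  rw [← c.isAdmissible.right_inv g, ← c.mu_bounds.inner_op_left, c.isAdmissible.right_inv,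
    c.isAdmissible.right_inv]

/-- `quadraticPencil` unfolds to `schurOp` with `C = curl` and `ν = μ⁻¹`, as `maxwellPencil` does to
`systemOp`, so the abstract results apply up to definitional unfolding. -/
lemma hasDenseRange_quadraticPencil {ω : ℂ} (h : IsInjective (quadraticPencil c ω)) :
    HasDenseRange (quadraticPencil c ω) :=
  c.isAdmissible.hasDenseRange_of_isInjective c.inner_muInv_left c.eps_bounds.inner_op_left
    c.sigma_bounds.inner_op_left (isConjugation_conjL2 Ω) (conjL2_op _) (conjL2_op _)
    (conjL2_op _) h

lemma resolventSet_iff {ω : ℂ} (hω : ω ≠ 0) :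
    ω ∈ resolventSet (maxwellPencil c) ↔ ω ∈ resolventSet (quadraticPencil c) :=
  ⟨fun ⟨_, hQ⟩ => ⟨_, c.isAdmissible.isBoundedInverse_schurOp hω hQ⟩,
    fun ⟨_, hR⟩ => c.isAdmissible.exists_isBoundedInverse_systemOp hω hR⟩

lemma maxwellPencil_zero (hΩ : (Ω : Set R3).Nonempty) :
    ¬ IsPhiPlus (maxwellPencil c 0) ∧ ¬ IsPhiMinus (maxwellPencil c 0) := by
  have h := systemOp_zero (dense_curl_domain Ω) (curl₀_le_curl Ω)
    (not_finiteDimensional_nullSpace_curl₀ hΩ) c.eps.op c.mu.op c.sigma.op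
  exact ⟨fun h' => h.1 h'.2, fun h' => h.2 h'.2⟩

lemma quadraticPencil_zero (hΩ : (Ω : Set R3).Nonempty) :
    ¬ IsPhiPlus (quadraticPencil c 0) ∧ ¬ IsPhiMinus (quadraticPencil c 0) := by
  have h := schurOp_zero (dense_curl_domain Ω)
    (not_finiteDimensional_nullSpace_curl₀ hΩ) c.eps.op c.muInv.op c.sigma.op
  exact ⟨fun h' => h.1 h'.2, fun h' => h.2 h'.2⟩

lemma not_isInjective_zero (hΩ : (Ω : Set R3).Nonempty) :
    ¬ IsInjective (maxwellPencil c 0) ∧ ¬ IsInjective (quadraticPencil c 0) := by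
  have key : ∀ {X : Type} [NormedAddCommGroup X] [InnerProductSpace ℂ X] {T : X →ₗ.[ℂ] X},
      ¬ FiniteNullity T → ¬ IsInjective T := by
    intro X _ _ T hT hi
    refine hT (finiteNullity_iff.2 ?_)
    rw [isInjective_iff.1 hi]
    infer_instance
  exact ⟨key (systemOp_zero (dense_curl_domain Ω) (curl₀_le_curl Ω)
      (not_finiteDimensional_nullSpace_curl₀ hΩ) c.eps.op c.mu.op c.sigma.op).1,
    key (schurOp_zero (dense_curl_domain Ω)
      (not_finiteDimensional_nullSpace_curl₀ hΩ) c.eps.op c.muInv.op c.sigma.op).1⟩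

lemma isInjective_maxwellPencil_iff {ω : ℂ} (hω : ω ≠ 0) :
    IsInjective (maxwellPencil c ω) ↔ IsInjective (quadraticPencil c ω) :=
  c.isAdmissible.isInjective_iff _ _ hω

lemma hasDenseRange_maxwellPencil_iff {ω : ℂ} (hω : ω ≠ 0) :
    HasDenseRange (maxwellPencil c ω) ↔ HasDenseRange (quadraticPencil c ω) :=
  c.isAdmissible.hasDenseRange_iff _ _ hω

end MaxwellSystem

lemma diff_zero_eq_of_iff {s t : Set ℂ} (h : ∀ ω, ω ≠ 0 → (ω ∈ s ↔ ω ∈ t)) :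
    s \ {0} = t \ {0} := by
  ext ω
  exact and_congr_left fun hω => h ω hω

lemma eq_and_zero_mem_of_iff {s t : Set ℂ} (h : ∀ ω, ω ≠ 0 → (ω ∈ s ↔ ω ∈ t)) (hs : (0 : ℂ) ∈ s)
    (ht : (0 : ℂ) ∈ t) : s = t ∧ (0 : ℂ) ∈ s := by
  refine ⟨Set.ext fun ω => ?_, hs⟩
  by_cases hω : ω = 0
  · simp only [hω, hs, ht]
  · exact h ω hω

end Maxwell

end

theorem theorem4 (Ω : TopologicalSpace.Opens Maxwell.R3) (hΩ : (Ω : Set Maxwell.R3).Nonempty)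
    (c : Maxwell.Coefficients Ω) :
    -- resolvent sets and spectra away from `0`
    Maxwell.resolventSet (Maxwell.maxwellPencil c) \ {0}
        = Maxwell.resolventSet (Maxwell.quadraticPencil c) \ {0} ∧
    Maxwell.spectrum (Maxwell.maxwellPencil c) \ {0}
        = Maxwell.spectrum (Maxwell.quadraticPencil c) \ {0} ∧
    -- the resolvent of `V`: with `R = 𝓛(ω)⁻¹`, `A = curl₀ 𝓛(ω)⁻¹`, and `B`, `D` the closures
    -- of `𝓛(ω)⁻¹ curl` and `curl₀ 𝓛(ω)⁻¹ curl`
    (∀ ω ∈ Maxwell.resolventSet (Maxwell.maxwellPencil c), ω ≠ 0 ∧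
      ∃ R A B D : Maxwell.L2 Ω →L[ℂ] Maxwell.L2 Ω,
        Maxwell.IsBoundedInverse (Maxwell.quadraticPencil c ω) R ∧
        Maxwell.comp (Maxwell.curl₀ Ω) (Maxwell.ofBounded R) = Maxwell.ofBounded A ∧
        (Maxwell.comp (Maxwell.ofBounded R) (Maxwell.curl Ω)).IsClosable ∧
        (Maxwell.comp (Maxwell.ofBounded R) (Maxwell.curl Ω)).closure = Maxwell.ofBounded B ∧
        (Maxwell.comp (Maxwell.curl₀ Ω)
          (Maxwell.comp (Maxwell.ofBounded R) (Maxwell.curl Ω))).IsClosable ∧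
        (Maxwell.comp (Maxwell.curl₀ Ω)
          (Maxwell.comp (Maxwell.ofBounded R) (Maxwell.curl Ω))).closure = Maxwell.ofBounded D ∧
        Maxwell.IsBoundedInverse (Maxwell.maxwellPencil c ω)
          (Maxwell.blockOp
            (ω • R)
            (Complex.I • (B ∘L c.muInv.op))
            (-Complex.I • (c.muInv.op ∘L A))
            (ω⁻¹ • (-c.muInv.op + c.muInv.op ∘L D ∘L c.muInv.op)))) ∧
    -- point, continuous and residual spectra
    Maxwell.pointSpectrum (Maxwell.maxwellPencil c) \ {0}
        = Maxwell.pointSpectrum (Maxwell.quadraticPencil c) \ {0} ∧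
    Maxwell.continuousSpectrum (Maxwell.maxwellPencil c) \ {0}
        = Maxwell.continuousSpectrum (Maxwell.quadraticPencil c) \ {0} ∧
    Maxwell.residualSpectrum (Maxwell.maxwellPencil c) = ∅ ∧
    Maxwell.residualSpectrum (Maxwell.quadraticPencil c) = ∅ ∧
    -- essential spectra
    (Maxwell.essSpectrum1 (Maxwell.maxwellPencil c)
        = Maxwell.essSpectrum1 (Maxwell.quadraticPencil c) ∧
      (0 : ℂ) ∈ Maxwell.essSpectrum1 (Maxwell.maxwellPencil c)) ∧
    (Maxwell.essSpectrum2 (Maxwell.maxwellPencil c)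
        = Maxwell.essSpectrum2 (Maxwell.quadraticPencil c) ∧
      (0 : ℂ) ∈ Maxwell.essSpectrum2 (Maxwell.maxwellPencil c)) ∧
    (Maxwell.essSpectrum3 (Maxwell.maxwellPencil c)
        = Maxwell.essSpectrum3 (Maxwell.quadraticPencil c) ∧
      (0 : ℂ) ∈ Maxwell.essSpectrum3 (Maxwell.maxwellPencil c)) ∧
    (Maxwell.essSpectrum4 (Maxwell.maxwellPencil c)
        = Maxwell.essSpectrum4 (Maxwell.quadraticPencil c) ∧
      (0 : ℂ) ∈ Maxwell.essSpectrum4 (Maxwell.maxwellPencil c)) := by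
  have h := c.isAdmissible
  have hV0 := Maxwell.maxwellPencil_zero c hΩ
  have hL0 := Maxwell.quadraticPencil_zero c hΩ
  have hi0 := Maxwell.not_isInjective_zero c hΩ
  have hspec : ∀ ω, ω ≠ 0 → (ω ∈ Maxwell.spectrum (Maxwell.maxwellPencil c)
      ↔ ω ∈ Maxwell.spectrum (Maxwell.quadraticPencil c)) :=
    fun ω hω => not_congr (Maxwell.resolventSet_iff c hω)
  refine ⟨Maxwell.diff_zero_eq_of_iff fun ω hω => Maxwell.resolventSet_iff c hω,
    Maxwell.diff_zero_eq_of_iff hspec, fun ω hω => ?_,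
    Maxwell.diff_zero_eq_of_iff fun ω hω => not_congr (Maxwell.isInjective_maxwellPencil_iff c hω),
    Maxwell.diff_zero_eq_of_iff fun ω hω => and_congr (hspec ω hω)
      (and_congr (Maxwell.isInjective_maxwellPencil_iff c hω)
        (Maxwell.hasDenseRange_maxwellPencil_iff c hω)),
    Set.eq_empty_of_forall_notMem fun ω hω => ?_,
    Set.eq_empty_of_forall_notMem fun ω hω =>
      hω.2 (Maxwell.hasDenseRange_quadraticPencil c hω.1),
    Maxwell.eq_and_zero_mem_of_iff (fun ω hω => not_congr (or_congr
      (h.isPhiPlus_iff _ _ hω) (h.isPhiMinus_iff _ _ hω))) (not_or.2 hV0) (not_or.2 hL0),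
    Maxwell.eq_and_zero_mem_of_iff (fun ω hω => not_congr (h.isPhiPlus_iff _ _ hω)) hV0.1 hL0.1,
    Maxwell.eq_and_zero_mem_of_iff (fun ω hω => not_congr (h.isFredholm_iff _ _ hω))
      (fun h' => hV0.1 h'.1) (fun h' => hL0.1 h'.1),
    Maxwell.eq_and_zero_mem_of_iff (fun ω hω => not_congr (h.isFredholmIndexZero_iff _ _ hω))
      (fun h' => hV0.1 h'.1.1) (fun h' => hL0.1 h'.1.1)⟩
  -- A bounded inverse at `0` would make `V(0)` semi-Fredholm with finite nullity, which is
  -- excluded.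
  · obtain ⟨Q, hQ⟩ := hω
    have hω0 : ω ≠ 0 := by
      rintro rfl
      exact hV0.1 hQ.isPhiPlus
    exact ⟨hω0, h.inverse_formula hω0 hQ⟩
  -- At `0` injectivity fails; elsewhere injectivity passes to the quadratic pencil and dense range
  -- comes back.
  · have hω0 : ω ≠ 0 := by
      rintro rfl
      exact hi0.1 hω.1
    exact hω.2 ((Maxwell.hasDenseRange_maxwellPencil_iff c hω0).2
      (Maxwell.hasDenseRange_quadraticPencil c ((Maxwell.isInjective_maxwellPencil_iff c hω0).1 hω.1)))
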